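/- Let $\mu$ be a probability measure on $\mathbb{R}$ that is symmetric (invariant under $x\mapsto -x$) and absolutely continuous with respect to Lebesgue measure. Let $F_\mu(x)=\mu((-\infty,x])$, and assume that $x\mapsto\log(1-F_\mu(x))$ is convex on $\mathbb{R}^+=[0,\infty)$. For $s\in(0,1)$ let $F_\mu^{-1}(s)=\inf\{x: F_\mu(x)\ge s\}$ and $J_\mu(s)=F_\mu'(F_\mu^{-1}(s))$, where $F_\mu'$ denotes the right derivative of $F_\mu$ (the ordinary derivative wherever $F_\mu$ is differentiable). Then for all $s\in(0,1/2)$ the number $J_\mu(s)$ is well defined and positive and, for every $n$, every bounded $C^\infty$ function $f:\mathbb{R}^n\to\mathbb{R}$ and every median $m$ of $f$ under the product measure $\mu^n$, $$\int |f-m|\,d\mu^n\;\le\;\kappa_1\,\frac{s}{J_\mu(s)}\int|\nabla f|\,d\mu^n+\kappa_2\,n\,s\,\mathrm{Osc}(f),\qquad \kappa_1=2\sqrt6,\quad \kappa_2=2(1+2\sqrt6).$$ Here $|\nabla f|$ is the Euclidean norm of the gradient, $\int|\nabla f|\,d\mu^n\in[0,\infty]$, $m$ is a median if $\mu^n(f\le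 m)\ge\frac12$ and $\mu^n(f\ge m)\ge\frac12$, and $\mathrm{Osc}(f)=\operatorname{ess\,sup}f-\operatorname{ess\,inf}f$ with respect to $\mu^n$. -/

import Mathlib

open MeasureTheory ProbabilityTheory
open scoped ENNReal ContDiff

noncomputable section

/-- The tail distribution function `x ↦ 1 - F_μ(x)` of a probability measure `μ` on the line. -/
def tailFunction (μ : Measure ℝ) (x : ℝ) : ℝ := 1 - cdf μ x

/-- The (generalized) inverse `F_μ⁻¹` of the cumulative distribution function of `μ`. -/
def cdfInverse (μ : Measure ℝ) (t : ℝ) : ℝ := sInf {x : ℝ | t ≤ cdf μ x}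

/-- The isoperimetric function `J_μ = F_μ' ∘ F_μ⁻¹`. A distribution function with convex
log-tail may have countably many kinks on the half line, so `F_μ'` is the right derivative. It is
the usual derivative wherever the latter exists, see `isoperimetricFunction_eq_of_hasDerivAt`. -/
def isoperimetricFunction (μ : Measure ℝ) (t : ℝ) : ℝ :=
  derivWithin (cdf μ) (Set.Ioi (cdfInverse μ t)) (cdfInverse μ t)

theorem isoperimetricFunction_eq_of_hasDerivAt (μ : Measure ℝ) (t v : ℝ)
    (h : HasDerivAt (cdf μ) v (cdfInverse μ t)) : isoperimetricFunction μ t = v :=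
  h.hasDerivWithinAt.derivWithin (uniqueDiffWithinAt_Ioi _)

/-- The product measure `μⁿ`, as a measure on Euclidean space. -/
def productMeasure (μ : Measure ℝ) (n : ℕ) : Measure (EuclideanSpace ℝ (Fin n)) :=
  (Measure.pi fun _ : Fin n => μ).map (MeasurableEquiv.toLp 2 (Fin n → ℝ))

/-- `m` is a median of `f` under the probability measure `P`. -/
def IsMedian {Ω : Type*} [MeasurableSpace Ω] (P : Measure Ω) (f : Ω → ℝ) (m : ℝ) : Prop :=
  1 / 2 ≤ P {x | f x ≤ m} ∧ 1 / 2 ≤ P {x | m ≤ f x}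

/-- The oscillation `ess sup f - ess inf f` of a bounded function. -/
def essOscillation {Ω : Type*} [MeasurableSpace Ω] (P : Measure Ω) (f : Ω → ℝ) : ℝ :=
  essSup f P - essInf f P

end

/-! ### A smooth step -/

/-! Put `F = cdf μ`, `b = F⁻¹(s) < 0`, `J = J_μ(s)`, `c = s / J`. Convexity of the log-tail makes
the tails at least exponentially heavy, so `μ` itself need not satisfy a Cheeger inequality. Its
truncation `ν`, the image of `μ` under clamping to `[b, -b]`, does, with constant `c`. By symmetry
`log F` is convex on the negative half-line, so `F' / F ≥ J / s` almost everywhere on `(b, 0)`;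
Fubini turns `F ≤ c F'` into `∫ |h| dν ≤ c ∫ |h'| dν` for `h 0 = 0` (`cheegerAtZero_map_clampSymm`).

To obtain a dimension-free constant, the Cheeger inequality is upgraded to a functional inequality
of Bobkov type, `I(∫ h) ≤ ∫ √(I(h)² + 6 c² |∇h|²)` with `I(p) = p (1 - p)`. This form tensorises
(`CheegerAtZero.functional_ineq_pi`). Applied to smoothed indicators of the level sets `{g > t}` and
integrated in `t`, a coarea argument, it gives `∫ |g| dνⁿ ≤ 2√6 c ∫ |∇g| dνⁿ` when `0` is a median
of `g` (`CheegerAtZero.integral_abs_le`).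

To return to `μⁿ`, take `g = (f - m) ∏ ψ(x_j)` with a cutoff `ψ` supported in `[b, -b]`, so that `g`
does not see the clamping (`lintegral_abs_sub_le_of_cutoff`). The cutoff costs two multiples of `n
Osc(f)`: about `2J` for its gradient, since `F` is convex on the negative half-line and its density
below `b` is at most `J`, and about `2s` for the mass outside the interval. As the cutoff sharpens,
the total is `2√6 (s / J) · 2J + 2s = 2 (1 + 2√6) s`. -/

theorem exists_step : ∃ θ θ' : ℝ → ℝ, (∀ x, HasDerivAt θ (θ' x) x) ∧ Continuous θ' ∧
    (∀ x, 0 ≤ θ' x) ∧ (∀ x, θ' x ≤ 2) ∧ (∀ x ≤ 0, θ x = 0) ∧ (∀ x, 1 ≤ x → θ x = 1) ∧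
    (∀ x, 0 ≤ θ x) ∧ (∀ x, θ x ≤ 1) ∧ (∀ x ≤ 0, θ' x = 0) ∧ (∀ x, 1 ≤ x → θ' x = 0) := by
  -- The factor `6` normalises `∫₀¹ t (1 - t) dt = 1 / 6`. Only `C¹` regularity is needed
  -- throughout.
  set θ' : ℝ → ℝ := fun t => 6 * max 0 (t * (1 - t)) with hθ'
  have hc : Continuous θ' := by fun_prop
  have hnn : ∀ x, 0 ≤ θ' x := fun x => by positivity
  have hd : ∀ x, HasDerivAt (fun x => ∫ t in (0 : ℝ)..x, θ' t) (θ' x) x := fun x =>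
    (hc.integral_hasStrictDerivAt 0 x).hasDerivAt
  have hl' : ∀ x ≤ 0, θ' x = 0 := fun x hx => by
    have : x * (1 - x) ≤ 0 := by nlinarith
    simp [hθ', this]
  have hr' : ∀ x, 1 ≤ x → θ' x = 0 := fun x hx => by
    have : x * (1 - x) ≤ 0 := by nlinarith
    simp [hθ', this]
  have hmono : Monotone (fun x => ∫ t in (0 : ℝ)..x, θ' t) :=
    monotone_of_deriv_nonneg (fun x => (hd x).differentiableAt) fun x => by
      rw [(hd x).deriv]; exact hnn x
  have hl : ∀ x ≤ 0, (∫ t in (0 : ℝ)..x, θ' t) = 0 := fun x hx => by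
    rw [intervalIntegral.integral_congr (g := fun _ => 0)]
    · simp
    · intro t ht
      rw [Set.uIcc_of_ge hx] at ht
      exact hl' t ht.2
  have h1 : (∫ t in (0 : ℝ)..1, θ' t) = 1 := by
    have : ∫ t in (0 : ℝ)..1, θ' t = ∫ t in (0 : ℝ)..1, 6 * (t - t ^ 2) := by
      refine intervalIntegral.integral_congr fun t ht => ?_
      rw [Set.uIcc_of_le zero_le_one] at ht
      have : 0 ≤ t * (1 - t) := mul_nonneg ht.1 (by linarith [ht.2])
      simp only [hθ', max_eq_right this]
      ring
    rw [this, intervalIntegral.integral_const_mul, intervalIntegral.integral_sub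
      (by simp) (by simp), integral_id, integral_pow]
    norm_num
  have hr : ∀ x, 1 ≤ x → (∫ t in (0 : ℝ)..x, θ' t) = 1 := fun x hx => by
    rw [← intervalIntegral.integral_add_adjacent_intervals (b := 1)
      (hc.intervalIntegrable _ _) (hc.intervalIntegrable _ _), h1,
      intervalIntegral.integral_congr (a := 1) (g := fun _ => 0)]
    · simp
    · intro t ht
      rw [Set.uIcc_of_le hx] at ht
      exact hr' t ht.1
  refine ⟨_, θ', hd, hc, hnn, fun x => ?_, hl, hr, fun x => ?_, fun x => ?_, hl', hr'⟩
  · have : max 0 (x * (1 - x)) ≤ 1 / 4 := max_le (by norm_num) (by nlinarith [sq_nonneg (x - 1/2)])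
    simp only [hθ']; linarith
  · rcases le_total x 0 with h | h
    · exact (hl x h).ge
    · exact (hl 0 le_rfl).symm.trans_le (hmono h)
  · rcases le_total x 1 with h | h
    · exact (hmono h).trans h1.le
    · exact (hr x h).le

/-! ### The functional inequality on the line -/

/-- This is where the constant `6` arises: equality holds at `x = 1`, `y = 1 / 2`, `v = 1 / 4`.
Since `√(v² + 6y²) - v` decreases in `v`, the worst case is `v = 1 / 4`; there, after squaring,
completing the square in `y` leaves a nonnegative remainder because `x ≤ 1`. -/
theorem quadratic_sub_le_sqrt {x y v : ℝ} (hx0 : 0 ≤ x) (hx1 : x ≤ 1) (hv : v ≤ 1 / 4) :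
    v + (12 / 5 * (x * y) - x ^ 2 / 5) ≤ √(v ^ 2 + 6 * y ^ 2) := by
  have key : 12 / 5 * (x * y) - x ^ 2 / 5 + 1 / 4 ≤ √(1 / 16 + 6 * y ^ 2) := by
    refine Real.le_sqrt_of_sq_le ?_
    have hu0 : 0 ≤ x ^ 2 := sq_nonneg x
    have hu1 : x ^ 2 ≤ 1 := by nlinarith
    set A := 6 - 144 * x ^ 2 / 25 with hA
    have hApos : 0 < A := by rw [hA]; linarith
    have h : 0 ≤ A * (1 / 16 + 6 * y ^ 2 - (12 / 5 * (x * y) - x ^ 2 / 5 + 1 / 4) ^ 2) := by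
      have : A * (1 / 16 + 6 * y ^ 2 - (12 / 5 * (x * y) - x ^ 2 / 5 + 1 / 4) ^ 2)
          = (A * y - 12 / 5 * x * (1 / 4 - x ^ 2 / 5)) ^ 2 + 6 / 25 * x ^ 2 * (1 - x ^ 2) := by
        rw [hA]; ring
      rw [this]
      have : 0 ≤ 1 - x ^ 2 := by linarith
      positivity
    have := nonneg_of_mul_nonneg_right h hApos
    linarith
  set S := √(1 / 16 + 6 * y ^ 2) with hS
  have hS2 : S ^ 2 = 1 / 16 + 6 * y ^ 2 := Real.sq_sqrt (by positivity)
  have hS4 : 1 / 4 ≤ S := Real.le_sqrt_of_sq_le (by nlinarith [sq_nonneg y])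
  have : v + (S - 1 / 4) ≤ √(v ^ 2 + 6 * y ^ 2) := Real.le_sqrt_of_sq_le (by nlinarith)
  linarith

/-- A Cheeger type inequality for `C¹` functions on the line that vanish at the origin. -/
def CheegerAtZero (ν : Measure ℝ) (c : ℝ) : Prop :=
  ∀ h h' : ℝ → ℝ, (∀ x, HasDerivAt h (h' x) x) → Continuous h' → h 0 = 0 →
    ∫⁻ x, ENNReal.ofReal |h x| ∂ν ≤ ENNReal.ofReal c * ∫⁻ x, ENNReal.ofReal |h' x| ∂ν

theorem integrable_of_continuous_of_bounded {X : Type*} [TopologicalSpace X] [MeasurableSpace X]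
    [OpensMeasurableSpace X] {P : Measure X} [IsFiniteMeasure P] {h : X → ℝ}
    (hc : Continuous h) {C : ℝ} (hC : ∀ x, |h x| ≤ C) : Integrable h P :=
  Integrable.of_bound hc.measurable.aestronglyMeasurable C (Filter.Eventually.of_forall hC)

/-- The identity `I(∫ h) = ∫ I(h) + Var h` reduces the claim to absorbing the variance, which is at
most `∫ (h - h 0)²`. Cheeger's inequality for `(h - h 0)²` bounds that by `2c ∫ |h - h 0| |h'|`.
Integrating `quadratic_sub_le_sqrt` with `y = c |h'|` closes the argument: `12/5` is `6/5` times
this `2`, and `6/5 - 1/5 = 1`. -/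
theorem CheegerAtZero.functional_ineq {ν : Measure ℝ} [IsProbabilityMeasure ν] {c : ℝ} (hc : 0 ≤ c)
    (hν : CheegerAtZero ν c) {h h' : ℝ → ℝ} (hd : ∀ x, HasDerivAt h (h' x) x)
    (hcont : Continuous h') {C : ℝ} (hC : ∀ x, |h' x| ≤ C) (h0 : ∀ x, 0 ≤ h x)
    (h1 : ∀ x, h x ≤ 1) :
    (∫ x, h x ∂ν) * (1 - ∫ x, h x ∂ν) ≤
      ∫ x, √((h x * (1 - h x)) ^ 2 + 6 * c ^ 2 * h' x ^ 2) ∂ν := by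
  have hch : Continuous h := continuous_iff_continuousAt.2 fun x => (hd x).continuousAt
  have habs : ∀ x, |h x - h 0| ≤ 1 := fun x => abs_le.2 ⟨by linarith [h0 x, h1 0], by
    linarith [h1 x, h0 0]⟩
  have ih : Integrable h ν := integrable_of_continuous_of_bounded hch (C := 1) fun x =>
    abs_le.2 ⟨by linarith [h0 x], h1 x⟩
  have iv : Integrable (fun x => h x * (1 - h x)) ν :=
    integrable_of_continuous_of_bounded (by fun_prop) (C := 1) fun x => by
      rw [abs_le]; constructor <;> nlinarith [h0 x, h1 x]
  have isq : Integrable (fun x => (h x - h 0) ^ 2) ν :=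
    integrable_of_continuous_of_bounded (by fun_prop) (C := 1) fun x => by
      rw [abs_of_nonneg (sq_nonneg _)]; exact (sq_le_one_iff_abs_le_one _).2 (habs x)
  have ixy : Integrable (fun x => |h x - h 0| * |h' x|) ν :=
    integrable_of_continuous_of_bounded (by fun_prop) (C := 1 * C) fun x => by
      rw [abs_mul, abs_abs, abs_abs]
      exact mul_le_mul (habs x) (hC x) (abs_nonneg _) zero_le_one
  have irhs : Integrable (fun x => √((h x * (1 - h x)) ^ 2 + 6 * c ^ 2 * h' x ^ 2)) ν :=
    integrable_of_continuous_of_bounded (by fun_prop) (C := √(1 + 6 * c ^ 2 * C ^ 2)) fun x => by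
      rw [abs_of_nonneg (Real.sqrt_nonneg _)]
      have a1 : |h x * (1 - h x)| ≤ 1 := by
        rw [abs_le]; constructor <;> nlinarith [h0 x, h1 x]
      have a2 : (h x * (1 - h x)) ^ 2 ≤ 1 := (sq_le_one_iff_abs_le_one _).2 a1
      have a3 : h' x ^ 2 ≤ C ^ 2 := sq_le_sq' (abs_le.1 (hC x)).1 (abs_le.1 (hC x)).2
      gcongr
  have cheeger : ∫ x, (h x - h 0) ^ 2 ∂ν ≤ c * (2 * ∫ x, |h x - h 0| * |h' x| ∂ν) := by
    have := hν (fun x => (h x - h 0) ^ 2) (fun x => 2 * (h x - h 0) * h' x)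
      (fun x => by
        simpa using ((hd x).sub_const (h 0)).fun_pow 2) (by fun_prop) (by simp)
    simp only [abs_mul, abs_pow, sq_abs, abs_two, mul_assoc] at this
    rw [← ofReal_integral_eq_lintegral_ofReal isq (Filter.Eventually.of_forall fun x => sq_nonneg _),
      ← ofReal_integral_eq_lintegral_ofReal (ixy.const_mul 2)
        (Filter.Eventually.of_forall fun x => by positivity), ← ENNReal.ofReal_mul hc,
      integral_const_mul] at this
    exact (ENNReal.ofReal_le_ofReal_iff (mul_nonneg hc (mul_nonneg zero_le_two
      (integral_nonneg fun x => by positivity)))).1 this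
  have var : (∫ x, h x ∂ν) * (1 - ∫ x, h x ∂ν) ≤
      (∫ x, h x * (1 - h x) ∂ν) + ∫ x, (h x - h 0) ^ 2 ∂ν := by
    rw [← integral_add iv isq]
    have : (fun x => h x * (1 - h x) + (h x - h 0) ^ 2) =
        fun x => (1 - 2 * h 0) * h x + h 0 ^ 2 := by ext x; ring
    rw [this, integral_add (ih.const_mul _) (integrable_const _), integral_const_mul]
    simp only [integral_const, probReal_univ, one_smul]
    nlinarith [sq_nonneg ((∫ x, h x ∂ν) - h 0)]
  have pt : ∫ x, (h x * (1 - h x) + (12 / 5 * c * (|h x - h 0| * |h' x|) -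
      1 / 5 * (h x - h 0) ^ 2)) ∂ν ≤
      ∫ x, √((h x * (1 - h x)) ^ 2 + 6 * c ^ 2 * h' x ^ 2) ∂ν := by
    refine integral_mono (iv.add ((ixy.const_mul _).sub (isq.const_mul _))) irhs fun x => ?_
    have := quadratic_sub_le_sqrt (x := |h x - h 0|) (y := c * |h' x|) (v := h x * (1 - h x))
      (abs_nonneg _) (habs x) (by nlinarith [sq_nonneg (h x - 1 / 2)])
    rw [sq_abs, mul_pow c, sq_abs] at this
    refine le_trans (le_of_eq ?_) (this.trans_eq ?_)
    · ring
    · rw [mul_assoc]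
  rw [integral_add iv ((ixy.const_mul (12 / 5 * c)).sub' (isq.const_mul (1 / 5))),
    integral_sub (ixy.const_mul _) (isq.const_mul _), integral_const_mul, integral_const_mul] at pt
  linarith

/-! ### Tensorisation -/

/-- `D i` is the partial derivative of `G` in the direction `i`. -/
def HasPartialDerivs {n : ℕ} (G : (Fin n → ℝ) → ℝ) (D : Fin n → (Fin n → ℝ) → ℝ) : Prop :=
  ∀ i x, HasDerivAt (fun t => G (Function.update x i t)) (D i x) (x i)

theorem integral_pi_succ {ν : Measure ℝ} [IsProbabilityMeasure ν] {n : ℕ}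
    {H : (Fin (n + 1) → ℝ) → ℝ} (hH : Continuous H) {C : ℝ} (hC : ∀ x, |H x| ≤ C) :
    ∫ x, H x ∂(Measure.pi fun _ : Fin (n + 1) => ν) =
      ∫ t, ∫ y, H (Fin.cons t y : Fin (n + 1) → ℝ) ∂(Measure.pi fun _ : Fin n => ν) ∂ν := by
  have e := (measurePreserving_piFinSuccAbove (fun _ : Fin (n + 1) => ν) 0).symm
  have hcons : Continuous fun p : ℝ × (Fin n → ℝ) => (Fin.cons p.1 p.2 : Fin (n + 1) → ℝ) :=
    Continuous.finCons (A := fun _ : Fin (n + 1) => ℝ) continuous_fst continuous_snd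
  rw [← e.integral_comp']
  have : ∀ p, (MeasurableEquiv.piFinSuccAbove (fun _ : Fin (n + 1) => ℝ) 0).symm p =
      (Fin.cons p.1 p.2 : Fin (n + 1) → ℝ) := fun p => Fin.insertNth_zero' _ _
  simp_rw [this]
  exact integral_prod _ (integrable_of_continuous_of_bounded (hH.comp hcons) fun p => hC _)

/-- Minkowski's inequality: the norm of the integral of `A + iB` is at most the integral of its
norm. -/
theorem sqrt_sq_integral_add_le {X : Type*} [MeasurableSpace X] {P : Measure X} {A B : X → ℝ}
    (hA : Integrable A P) (hB : Integrable B P) :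
    √((∫ x, A x ∂P) ^ 2 + (∫ x, B x ∂P) ^ 2) ≤ ∫ x, √(A x ^ 2 + B x ^ 2) ∂P := by
  have key : ∀ a b : ℝ, √(a ^ 2 + b ^ 2) = ‖(a : ℂ) + b * Complex.I‖ := fun a b =>
    (Complex.norm_add_mul_I a b).symm
  simp_rw [key]
  have := norm_integral_le_integral_norm (μ := P) fun x => (A x : ℂ) + B x * Complex.I
  rw [integral_add hA.ofReal (hB.ofReal.mul_const _), integral_mul_const] at this
  rwa [integral_complex_ofReal, integral_complex_ofReal] at this

/-- Bobkov's induction. The one-dimensional inequality is applied to the partial average `u t = ∫ G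
(t, y) dy`, the induction hypothesis on each fibre bounds `I(u t)` by the average of `A`, and
Minkowski's inequality recombines the two terms under one square root. -/
theorem CheegerAtZero.functional_ineq_pi {ν : Measure ℝ} [IsProbabilityMeasure ν] {c : ℝ}
    (hc : 0 ≤ c) (hν : CheegerAtZero ν c) (n : ℕ) :
    ∀ {G : (Fin n → ℝ) → ℝ} {D : Fin n → (Fin n → ℝ) → ℝ}, Continuous G → (∀ i, Continuous (D i)) →
      HasPartialDerivs G D → ∀ {C : ℝ}, (∀ i x, |D i x| ≤ C) → (∀ x, 0 ≤ G x) → (∀ x, G x ≤ 1) →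
      (∫ x, G x ∂(Measure.pi fun _ => ν)) * (1 - ∫ x, G x ∂(Measure.pi fun _ => ν)) ≤
        ∫ x, √((G x * (1 - G x)) ^ 2 + 6 * c ^ 2 * ∑ i, D i x ^ 2) ∂(Measure.pi fun _ => ν) := by
  induction n with
  | zero =>
    intro G D hG hD hGD C hC h0 h1
    have hx : ∀ x, x = (0 : Fin 0 → ℝ) := fun x => Subsingleton.elim _ _
    have hG' : G = fun _ => G 0 := funext fun x => by rw [hx x]
    rw [hG']
    simp only [integral_const, probReal_univ, one_smul, Finset.univ_eq_empty, Finset.sum_empty,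
      mul_zero, add_zero]
    exact (Real.sqrt_sq (mul_nonneg (h0 0) (sub_nonneg.2 (h1 0)))).ge
  | succ n ih =>
    intro G D hG hD hGD C hC h0 h1
    set P : Measure (Fin n → ℝ) := Measure.pi fun _ => ν
    have hcons : Continuous fun p : ℝ × (Fin n → ℝ) => (Fin.cons p.1 p.2 : Fin (n + 1) → ℝ) :=
      Continuous.finCons (A := fun _ : Fin (n + 1) => ℝ) continuous_fst continuous_snd
    have hcons₁ : ∀ t, Continuous fun y : Fin n → ℝ => (Fin.cons t y : Fin (n + 1) → ℝ) :=
      fun t => hcons.comp (by fun_prop : Continuous fun y : Fin n → ℝ => (t, y))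
    have hcons₂ : ∀ y : Fin n → ℝ, Continuous fun t : ℝ => (Fin.cons t y : Fin (n + 1) → ℝ) :=
      fun y => hcons.comp (by fun_prop : Continuous fun t : ℝ => (t, y))
    have hvb : ∀ x, |G x * (1 - G x)| ≤ 1 := fun x => by
      rw [abs_le]; constructor <;> nlinarith [h0 x, h1 x]
    have hDsq : ∀ i x, D i x ^ 2 ≤ C ^ 2 := fun i x =>
      sq_le_sq' (abs_le.1 (hC i x)).1 (abs_le.1 (hC i x)).2
    set A : (Fin (n + 1) → ℝ) → ℝ := fun x =>
      √((G x * (1 - G x)) ^ 2 + 6 * c ^ 2 * ∑ i : Fin n, D i.succ x ^ 2) with hA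
    have hAc : Continuous A := by fun_prop
    have hAb : ∀ x, |A x| ≤ √(1 + 6 * c ^ 2 * ∑ i : Fin n, C ^ 2) := fun x => by
      rw [abs_of_nonneg (Real.sqrt_nonneg _)]
      have := (sq_le_one_iff_abs_le_one _).2 (hvb x)
      exact Real.sqrt_le_sqrt (add_le_add this (mul_le_mul_of_nonneg_left
        (Finset.sum_le_sum fun i _ => hDsq _ _) (by positivity)))
    have hRc : Continuous fun x => √((G x * (1 - G x)) ^ 2 + 6 * c ^ 2 * ∑ i, D i x ^ 2) := by
      fun_prop
    have hRb : ∀ x, |√((G x * (1 - G x)) ^ 2 + 6 * c ^ 2 * ∑ i, D i x ^ 2)| ≤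
        √(1 + 6 * c ^ 2 * ∑ i : Fin (n + 1), C ^ 2) := fun x => by
      rw [abs_of_nonneg (Real.sqrt_nonneg _)]
      have := (sq_le_one_iff_abs_le_one _).2 (hvb x)
      exact Real.sqrt_le_sqrt (add_le_add this (mul_le_mul_of_nonneg_left
        (Finset.sum_le_sum fun i _ => hDsq _ _) (by positivity)))
    have hRA : ∀ x, √((G x * (1 - G x)) ^ 2 + 6 * c ^ 2 * ∑ i, D i x ^ 2) =
        √(A x ^ 2 + (√6 * c * D 0 x) ^ 2) := fun x => by
      rw [Real.sq_sqrt (by positivity), Fin.sum_univ_succ, mul_pow _ (D 0 x), mul_pow √6,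
        Real.sq_sqrt (by norm_num : (0 : ℝ) ≤ 6)]
      ring_nf
    have hGb : ∀ x, |G x| ≤ 1 := fun x => abs_le.2 ⟨by linarith [h0 x], h1 x⟩
    set u : ℝ → ℝ := fun t => ∫ y, G (Fin.cons t y : Fin (n + 1) → ℝ) ∂P with hu
    set u' : ℝ → ℝ := fun t => ∫ y, D 0 (Fin.cons t y : Fin (n + 1) → ℝ) ∂P with hu'
    have hGi : ∀ t, Integrable (fun y => G (Fin.cons t y : Fin (n + 1) → ℝ)) P := fun t =>
      integrable_of_continuous_of_bounded (hG.comp (hcons₁ t)) fun y => hGb _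
    have hDi : ∀ t, Integrable (fun y => D 0 (Fin.cons t y : Fin (n + 1) → ℝ)) P := fun t =>
      integrable_of_continuous_of_bounded ((hD 0).comp (hcons₁ t)) fun y => hC _ _
    have hAi : ∀ t, Integrable (fun y => A (Fin.cons t y : Fin (n + 1) → ℝ)) P := fun t =>
      integrable_of_continuous_of_bounded (hAc.comp (hcons₁ t)) fun y => hAb _
    have hud : ∀ t, HasDerivAt u (u' t) t := fun t => by
      refine (hasDerivAt_integral_of_dominated_loc_of_deriv_le (bound := fun _ => C)
        (F' := fun t y => D 0 (Fin.cons t y : Fin (n + 1) → ℝ)) Filter.univ_mem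
        (Filter.Eventually.of_forall fun t => (hGi t).aestronglyMeasurable) (hGi t)
        (hDi t).aestronglyMeasurable (Filter.Eventually.of_forall fun y t _ => hC _ _)
        (integrable_const _) (Filter.Eventually.of_forall fun y t _ => ?_)).2
      simpa using hGD 0 (Fin.cons t y : Fin (n + 1) → ℝ)
    have hu'c : Continuous u' := by
      refine continuous_of_dominated (bound := fun _ => C)
        (fun t => (hDi t).aestronglyMeasurable) (fun t => Filter.Eventually.of_forall fun y => hC _ _)
        (integrable_const _) (Filter.Eventually.of_forall fun y => (hD 0).comp (hcons₂ y))
    have hintC : ∀ r : ℝ, ∫ _ : Fin n → ℝ, r ∂P = r := fun r => by simp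
    have hu'b : ∀ t, |u' t| ≤ C := fun t => by
      have := norm_integral_le_of_norm_le_const (μ := P)
        (f := fun y => D 0 (Fin.cons t y : Fin (n + 1) → ℝ))
        (Filter.Eventually.of_forall fun y => hC 0 (Fin.cons t y : Fin (n + 1) → ℝ))
      simpa using this
    have hu0 : ∀ t, 0 ≤ u t := fun t => integral_nonneg fun y => h0 _
    have hu1 : ∀ t, u t ≤ 1 := fun t => by
      rw [← hintC 1]
      exact integral_mono (hGi t) (integrable_const _) fun y => h1 _
    have step1 := hν.functional_ineq hc hud hu'c hu'b hu0 hu1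
    rw [integral_pi_succ hG hGb, integral_pi_succ hRc hRb]
    refine step1.trans (integral_mono_of_nonneg (Filter.Eventually.of_forall fun t =>
      Real.sqrt_nonneg _) ?_ (Filter.Eventually.of_forall fun t => ?_))
    · have hcont : Continuous fun t => ∫ y, √((G (Fin.cons t y : Fin (n + 1) → ℝ) *
          (1 - G (Fin.cons t y : Fin (n + 1) → ℝ))) ^ 2 + 6 * c ^ 2 *
          ∑ i, D i (Fin.cons t y : Fin (n + 1) → ℝ) ^ 2) ∂P :=
        continuous_of_dominated
          (fun t => (hRc.comp (hcons₁ t)).measurable.aestronglyMeasurable)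
          (fun t => Filter.Eventually.of_forall fun y => hRb _)
          (integrable_const _) (Filter.Eventually.of_forall fun y => hRc.comp (hcons₂ y))
      refine integrable_of_continuous_of_bounded hcont
        (C := √(1 + 6 * c ^ 2 * ∑ i : Fin (n + 1), C ^ 2)) fun t => ?_
      have := norm_integral_le_of_norm_le_const (μ := P)
        (f := fun y => √((G (Fin.cons t y : Fin (n + 1) → ℝ) *
          (1 - G (Fin.cons t y : Fin (n + 1) → ℝ))) ^ 2 + 6 * c ^ 2 *
          ∑ i, D i (Fin.cons t y : Fin (n + 1) → ℝ) ^ 2))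
        (Filter.Eventually.of_forall fun y => hRb (Fin.cons t y : Fin (n + 1) → ℝ))
      rwa [probReal_univ, mul_one] at this
    · have hI := ih (G := fun y => G (Fin.cons t y : Fin (n + 1) → ℝ))
        (D := fun i y => D i.succ (Fin.cons t y : Fin (n + 1) → ℝ)) (hG.comp (hcons₁ t))
        (fun i => (hD _).comp (hcons₁ t)) (fun i y => by
          simpa [Fin.cons_update] using hGD i.succ (Fin.cons t y : Fin (n + 1) → ℝ))
        (fun i y => hC _ _) (fun y => h0 _) (fun y => h1 _)
      have hle : √((u t * (1 - u t)) ^ 2 + 6 * c ^ 2 * u' t ^ 2) ≤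
          √((∫ y, A (Fin.cons t y : Fin (n + 1) → ℝ) ∂P) ^ 2 +
            (∫ y, √6 * c * D 0 (Fin.cons t y : Fin (n + 1) → ℝ) ∂P) ^ 2) := by
        rw [integral_const_mul, mul_pow (√6 * c), mul_pow √6, Real.sq_sqrt (by norm_num : (0 : ℝ) ≤ 6)]
        have : 0 ≤ u t * (1 - u t) := mul_nonneg (hu0 t) (sub_nonneg.2 (hu1 t))
        gcongr
      refine hle.trans ((sqrt_sq_integral_add_le (hAi t) ((hDi t).const_mul _)).trans_eq ?_)
      simp_rw [hRA]
      rfl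

/-! ### From the functional inequality to an `L¹` inequality -/

/-- The coarea argument. Restricting the gradient to `{g > 0}` is what later allows the bounds for
`g` and `-g` to be added without counting the gradient twice. -/
theorem CheegerAtZero.integral_posPart_le {ν : Measure ℝ} [IsProbabilityMeasure ν] {c : ℝ}
    (hc : 0 ≤ c) (hν : CheegerAtZero ν c) {n : ℕ} {g : (Fin n → ℝ) → ℝ}
    {D : Fin n → (Fin n → ℝ) → ℝ} (hg : Continuous g) (hD : ∀ i, Continuous (D i))
    (hgD : HasPartialDerivs g D) {M C : ℝ} (hM : ∀ x, |g x| ≤ M) (hC : ∀ i x, |D i x| ≤ C)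
    (hmed : (Measure.pi fun _ => ν).real {x | 0 < g x} ≤ 1 / 2) :
    ∫ x, max (g x) 0 ∂(Measure.pi fun _ => ν) ≤
      2 * √6 * c * ∫ x, {x | 0 < g x}.indicator (fun x => √(∑ i, D i x ^ 2)) x
        ∂(Measure.pi fun _ => ν) := by
  set P : Measure (Fin n → ℝ) := Measure.pi fun _ => ν
  obtain ⟨θ, θ', hθ, hθc', hθ'0, hθ'2, hθl, hθr, hθ0, hθ1, -, -⟩ := exists_step
  have hθc : Continuous θ := continuous_iff_continuousAt.2 fun x => (hθ x).continuousAt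
  set N : (Fin n → ℝ) → ℝ := fun x => √(∑ i, D i x ^ 2) with hN
  have hNc : Continuous N := by fun_prop
  have hN0 : ∀ x, 0 ≤ N x := fun x => Real.sqrt_nonneg _
  have hNb : ∀ x, N x ≤ √(∑ _i : Fin n, C ^ 2) := fun x =>
    Real.sqrt_le_sqrt (Finset.sum_le_sum fun i _ =>
      sq_le_sq' (abs_le.1 (hC i x)).1 (abs_le.1 (hC i x)).2)
  set K := √(∑ _i : Fin n, C ^ 2) with hK
  have hK0 : 0 ≤ K := Real.sqrt_nonneg _
  have hM0 : 0 ≤ M := (abs_nonneg _).trans (hM 0)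
  have hset : MeasurableSet {x | 0 < g x} := measurableSet_lt measurable_const hg.measurable
  have hNi : Integrable ({x | 0 < g x}.indicator N) P :=
    (integrable_of_continuous_of_bounded hNc (C := K) fun x => by
      rw [abs_of_nonneg (hN0 x)]; exact hNb x).indicator hset
  have hgi : Integrable (fun x => max (g x) 0) P :=
    integrable_of_continuous_of_bounded (by fun_prop) (C := M) fun x => by
      rw [abs_of_nonneg (le_max_right _ _)]; exact max_le ((le_abs_self _).trans (hM x)) hM0
  suffices H : ∀ ε > 0, (1 / 2) * ∫ x, max (g x) 0 ∂P ≤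
      √6 * c * (∫ x, {x | 0 < g x}.indicator N x ∂P) + ε by
    have := le_of_forall_pos_le_add H
    linarith
  intro ε hε
  -- A ramp of width `ε` replacing the indicator of `{g > t}`.
  set G : ℝ → (Fin n → ℝ) → ℝ := fun t x => θ ((g x - t) / ε) with hG
  set G' : ℝ → (Fin n → ℝ) → ℝ := fun t x => θ' ((g x - t) / ε) / ε with hG'
  have hG'0 : ∀ t x, 0 ≤ G' t x := fun t x => div_nonneg (hθ'0 _) hε.le
  have hG'b : ∀ t x, G' t x ≤ 2 / ε := fun t x => div_le_div_of_nonneg_right (hθ'2 _) hε.le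
  have hGc : ∀ t, Continuous (G t) := fun t => by simp only [hG]; fun_prop
  have hG'c : ∀ t, Continuous (G' t) := fun t => by simp only [hG']; fun_prop
  set Φ : ℝ → (Fin n → ℝ) → ℝ := fun t x =>
    G t x * (1 - G t x) + √6 * c * (G' t x * N x) - 1 / 2 * G t x with hΦ
  have hG01 : ∀ t x, 0 ≤ G t x ∧ G t x ≤ 1 := fun t x => ⟨hθ0 _, hθ1 _⟩
  have hGGb : ∀ t x, |G t x * (1 - G t x)| ≤ 1 := fun t x => by
    obtain ⟨h0, h1⟩ := hG01 t x
    rw [abs_le]; constructor <;> nlinarith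
  have hGNb : ∀ t x, |G' t x * N x| ≤ 2 / ε * K := fun t x => by
    rw [abs_of_nonneg (mul_nonneg (hG'0 t x) (hN0 x))]
    exact mul_le_mul (hG'b t x) (hNb x) (hN0 x) (by positivity)
  have hGi : ∀ t, Integrable (G t) P := fun t =>
    integrable_of_continuous_of_bounded (hGc t) (C := 1) fun x =>
      abs_le.2 ⟨by linarith [(hG01 t x).1], (hG01 t x).2⟩
  have hGGi : ∀ t, Integrable (fun x => G t x * (1 - G t x)) P := fun t =>
    integrable_of_continuous_of_bounded ((hGc t).mul (continuous_const.sub (hGc t))) (hGGb t)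
  have hGNi : ∀ t, Integrable (fun x => G' t x * N x) P := fun t =>
    integrable_of_continuous_of_bounded ((hG'c t).mul hNc) (hGNb t)
  -- the functional inequality at level `t`
  have level : ∀ t, 0 ≤ t → 0 ≤ ∫ x, Φ t x ∂P := fun t ht => by
    have h := hν.functional_ineq_pi hc n (G := G t) (D := fun i x => G' t x * D i x) (hGc t)
      (fun i => (hG'c t).mul (hD i)) (fun i x => by
        have h1 := ((hgD i x).sub_const t).div_const ε
        have h2 := (hθ ((g (Function.update x i (x i)) - t) / ε)).comp (x i) h1
        rw [Function.update_eq_self] at h2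
        refine h2.congr_deriv ?_
        simp only [hG']; ring)
      (C := 2 / ε * C) (fun i x => by
        rw [abs_mul, abs_of_nonneg (hG'0 t x)]
        exact mul_le_mul (hG'b t x) (hC i x) (abs_nonneg _) (by positivity))
      (fun x => (hG01 t x).1) (fun x => (hG01 t x).2)
    have hp : ∫ x, G t x ∂P ≤ 1 / 2 := by
      refine le_trans ?_ hmed
      rw [← integral_indicator_one hset]
      refine integral_mono (hGi t) ((integrable_const (1 : ℝ)).indicator hset) fun x => ?_
      by_cases hx : 0 < g x
      · simpa [Set.indicator, hx] using (hG01 t x).2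
      · have : (g x - t) / ε ≤ 0 := div_nonpos_of_nonpos_of_nonneg (by linarith) hε.le
        simp [Set.indicator, hx, hG, hθl _ this]
    have hp0 : 0 ≤ ∫ x, G t x ∂P := integral_nonneg fun x => (hG01 t x).1
    -- Uses `√(p² + q²) ≤ p + q` for nonnegative `p`, `q`.
    have hle : ∫ x, √((G t x * (1 - G t x)) ^ 2 + 6 * c ^ 2 * ∑ i, (G' t x * D i x) ^ 2) ∂P ≤
        ∫ x, (G t x * (1 - G t x) + √6 * c * (G' t x * N x)) ∂P := by
      refine integral_mono_of_nonneg (Filter.Eventually.of_forall fun x => Real.sqrt_nonneg _)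
        ((hGGi t).add ((hGNi t).const_mul _)) (Filter.Eventually.of_forall fun x => ?_)
      have hv : 0 ≤ G t x * (1 - G t x) := mul_nonneg (hG01 t x).1 (sub_nonneg.2 (hG01 t x).2)
      have hw : 0 ≤ √6 * c * (G' t x * N x) :=
        mul_nonneg (mul_nonneg (Real.sqrt_nonneg _) hc) (mul_nonneg (hG'0 t x) (hN0 x))
      refine Real.sqrt_le_iff.2 ⟨add_nonneg hv hw, ?_⟩
      have : (√6 * c * (G' t x * N x)) ^ 2 = 6 * c ^ 2 * ∑ i, (G' t x * D i x) ^ 2 := by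
        rw [mul_pow, mul_pow, mul_pow, hN, Real.sq_sqrt (by norm_num : (0 : ℝ) ≤ 6),
          Real.sq_sqrt (Finset.sum_nonneg fun i _ => sq_nonneg _), Finset.mul_sum]
        simp only [mul_pow]
      nlinarith
    have hsplit : ∫ x, Φ t x ∂P = (∫ x, (G t x * (1 - G t x) + √6 * c * (G' t x * N x)) ∂P) -
        1 / 2 * ∫ x, G t x ∂P := by
      rw [← integral_const_mul]
      exact integral_sub ((hGGi t).add ((hGNi t).const_mul _)) ((hGi t).const_mul _)
    rw [hsplit]
    -- As `p = ∫ G t ≤ 1 / 2`, one has `p (1 - p) ≥ p / 2`.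
    nlinarith [h.trans hle]
  set Q : Measure ℝ := volume.restrict (Set.Ioc 0 M) with hQ
  have hΦi : Integrable (Function.uncurry Φ) (Q.prod P) := by
    refine integrable_of_continuous_of_bounded ?_ (C := 1 + √6 * c * (2 / ε * K) + 1 / 2) ?_
    · simp only [hΦ, hG, hG', Function.uncurry_def]; fun_prop
    · rintro ⟨t, x⟩
      simp only [Function.uncurry_apply_pair, hΦ]
      have h1 := abs_le.1 (hGGb t x)
      have h2 := abs_le.1 (hGNb t x)
      have h3 := hG01 t x
      have h4 : 0 ≤ √6 * c := mul_nonneg (Real.sqrt_nonneg _) hc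
      have h5 := mul_le_mul_of_nonneg_left h2.1 h4
      have h6 := mul_le_mul_of_nonneg_left h2.2 h4
      rw [abs_le]
      constructor <;> linarith [h1.1, h1.2, h3.1, h3.2]
  have hpos : 0 ≤ ∫ x, ∫ t, Φ t x ∂Q ∂P := by
    rw [← integral_integral_swap hΦi]
    exact setIntegral_nonneg measurableSet_Ioc fun t ht => level t ht.1.le
  -- For fixed `x`, `G (1 - G)` vanishes unless `t` lies in a window of length `ε` below `g x`,
  -- whence the error `ε`. The term `-G / 2` recovers the positive part, and the `t`-integral of
  -- `G'` telescopes to `θ (g x / ε)`, which is zero when `g x ≤ 0`.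
  have hinner : ∀ x, ∫ t, Φ t x ∂Q ≤
      ε - 1 / 2 * max (g x) 0 + √6 * c * {x | 0 < g x}.indicator N x := fun x => by
    have hgM := abs_le.1 (hM x)
    have i1 : Integrable ((Set.Icc (g x - ε) (g x)).indicator (1 : ℝ → ℝ)) Q :=
      (integrable_const (1 : ℝ)).indicator measurableSet_Icc
    have i2 : Integrable ((Set.Iic (g x)).indicator (1 : ℝ → ℝ)) Q :=
      (integrable_const (1 : ℝ)).indicator measurableSet_Iic
    have i3 : Integrable (fun t => G' t x) Q :=
      integrable_of_continuous_of_bounded (by simp only [hG']; fun_prop) (C := 2 / ε) fun t => by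
        rw [abs_of_nonneg (hG'0 t x)]; exact hG'b t x
    have hb : ∫ t, Φ t x ∂Q ≤ ∫ t, ((Set.Icc (g x - ε) (g x)).indicator (1 : ℝ → ℝ) t -
        1 / 2 * (Set.Iic (g x)).indicator (1 : ℝ → ℝ) t + √6 * c * N x * G' t x) ∂Q := by
      refine integral_mono ?_ ((i1.sub (i2.const_mul _)).add (i3.const_mul _)) fun t => ?_
      · refine integrable_of_continuous_of_bounded (P := Q) (h := fun t => Φ t x)
          (C := 1 + √6 * c * (2 / ε * K) + 1 / 2) ?_ fun t => ?_
        · simp only [hΦ, hG, hG']; fun_prop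
        · simp only [hΦ]
          have h1 := abs_le.1 (hGGb t x)
          have h2 := abs_le.1 (hGNb t x)
          have h3 := hG01 t x
          have h4 : 0 ≤ √6 * c := mul_nonneg (Real.sqrt_nonneg _) hc
          have h5 := mul_le_mul_of_nonneg_left h2.1 h4
          have h6 := mul_le_mul_of_nonneg_left h2.2 h4
          rw [abs_le]
          constructor <;> linarith [h1.1, h1.2, h3.1, h3.2]
      · have hΦG : Φ t x = (G t x * (1 - G t x) - 1 / 2 * G t x) + √6 * c * N x * G' t x := by
          simp only [hΦ]; ring
        simp only [hΦG]
        refine add_le_add_left ?_ _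
        rcases lt_or_ge (g x) t with h | h
        · have h1 : t ∉ Set.Icc (g x - ε) (g x) := fun h' => absurd h'.2 (not_le.2 h)
          have h2 : t ∉ Set.Iic (g x) := not_le.2 h
          have h3 : G t x = 0 := hθl _ (div_nonpos_of_nonpos_of_nonneg (by linarith) hε.le)
          simp [h1, h2, h3]
        · have h2 : t ∈ Set.Iic (g x) := h
          rw [Set.indicator_of_mem h2]
          rcases lt_or_ge t (g x - ε) with h' | h'
          · have h1 : t ∉ Set.Icc (g x - ε) (g x) := fun h'' => absurd h''.1 (not_le.2 h')
            have h3 : G t x = 1 := hθr _ ((one_le_div hε).2 (by linarith))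
            simp [h1, h3]
          · have h1 : t ∈ Set.Icc (g x - ε) (g x) := ⟨h', h⟩
            rw [Set.indicator_of_mem h1]
            have := hG01 t x
            simp only [Pi.one_apply]
            nlinarith
    refine hb.trans ?_
    have e1 : ∫ t, (Set.Icc (g x - ε) (g x)).indicator (1 : ℝ → ℝ) t ∂Q ≤ ε := by
      rw [integral_indicator_one measurableSet_Icc]
      calc Q.real (Set.Icc (g x - ε) (g x)) ≤ volume.real (Set.Icc (g x - ε) (g x)) :=
            ENNReal.toReal_mono (by simp) (Measure.restrict_apply_le _ _)
        _ = ε := by rw [Real.volume_real_Icc]; simp [hε.le]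
    have e2 : ∫ t, (Set.Iic (g x)).indicator (1 : ℝ → ℝ) t ∂Q = max (g x) 0 := by
      rw [integral_indicator_one measurableSet_Iic, hQ, measureReal_restrict_apply measurableSet_Iic,
        Set.inter_comm, Set.Ioc_inter_Iic, min_eq_right hgM.2, Real.volume_real_Ioc, sub_zero]
    have e3 : ∫ t, G' t x ∂Q ≤ {x | 0 < g x}.indicator (1 : (Fin n → ℝ) → ℝ) x := by
      have hd : ∀ t, HasDerivAt (fun t => - θ ((g x - t) / ε)) (G' t x) t := fun t => by
        have h1 := ((hasDerivAt_id t).const_sub (g x)).div_const ε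
        have h2 := ((hθ ((g x - t) / ε)).comp t h1).neg
        refine h2.congr_deriv ?_
        simp only [hG']; ring
      rw [hQ, ← intervalIntegral.integral_of_le hM0,
        intervalIntegral.integral_eq_sub_of_hasDerivAt (fun t _ => hd t)
          (Continuous.intervalIntegrable (by simp only [hG']; fun_prop) _ _),
        hθl _ (div_nonpos_of_nonpos_of_nonneg (by linarith [hgM.2] : g x - M ≤ 0) hε.le)]
      by_cases hx : 0 < g x
      · simpa [Set.indicator, hx] using hθ1 _
      · simp only [Set.indicator, Set.mem_ofPred_eq, hx, if_false]
        rw [hθl _ (div_nonpos_of_nonpos_of_nonneg (by linarith) hε.le)]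
        simp
    rw [integral_add (i1.sub' (i2.const_mul (1 / 2))) (i3.const_mul _),
      integral_sub i1 (i2.const_mul _), integral_const_mul, integral_const_mul, e2]
    have e4 : √6 * c * N x * ∫ t, G' t x ∂Q ≤ √6 * c * {x | 0 < g x}.indicator N x := by
      have h0 : 0 ≤ √6 * c * N x := mul_nonneg (mul_nonneg (Real.sqrt_nonneg _) hc) (hN0 x)
      refine (mul_le_mul_of_nonneg_left e3 h0).trans_eq ?_
      by_cases hx : 0 < g x <;> simp [Set.indicator, hx]
    linarith
  have hfin : ∫ x, ∫ t, Φ t x ∂Q ∂P ≤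
      ∫ x, (ε - 1 / 2 * max (g x) 0 + √6 * c * {x | 0 < g x}.indicator N x) ∂P :=
    integral_mono hΦi.swap.integral_prod_left
      (((integrable_const ε).sub' (hgi.const_mul _)).add (hNi.const_mul _)) hinner
  rw [integral_add ((integrable_const ε).sub' (hgi.const_mul (1 / 2))) (hNi.const_mul _),
    integral_sub (integrable_const ε) (hgi.const_mul _), integral_const_mul, integral_const_mul,
    integral_const, probReal_univ, one_smul] at hfin
  linarith

/-- An `L¹` Poincaré inequality around a median for products of a measure on the line. -/
theorem CheegerAtZero.integral_abs_le {ν : Measure ℝ} [IsProbabilityMeasure ν] {c : ℝ}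
    (hc : 0 ≤ c) (hν : CheegerAtZero ν c) {n : ℕ} {g : (Fin n → ℝ) → ℝ}
    {D : Fin n → (Fin n → ℝ) → ℝ} (hg : Continuous g) (hD : ∀ i, Continuous (D i))
    (hgD : HasPartialDerivs g D) {M C : ℝ} (hM : ∀ x, |g x| ≤ M) (hC : ∀ i x, |D i x| ≤ C)
    (hpos : (Measure.pi fun _ => ν).real {x | 0 < g x} ≤ 1 / 2)
    (hneg : (Measure.pi fun _ => ν).real {x | g x < 0} ≤ 1 / 2) :
    ∫ x, |g x| ∂(Measure.pi fun _ => ν) ≤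
      2 * √6 * c * ∫ x, √(∑ i, D i x ^ 2) ∂(Measure.pi fun _ => ν) := by
  set P : Measure (Fin n → ℝ) := Measure.pi fun _ => ν
  have h1 := hν.integral_posPart_le hc hg hD hgD hM hC hpos
  have h2 := hν.integral_posPart_le hc (g := fun x => - g x) (D := fun i x => - D i x) hg.neg
    (fun i => (hD i).neg) (fun i x => (hgD i x).neg) (M := M) (C := C)
    (fun x => by rw [abs_neg]; exact hM x) (fun i x => by rw [abs_neg]; exact hC i x)
    (by simpa using hneg)
  simp only [neg_sq, Left.neg_pos_iff] at h2
  have hM0 : 0 ≤ M := (abs_nonneg _).trans (hM 0)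
  have hgi : ∀ f : (Fin n → ℝ) → ℝ, Continuous f → (∀ x, |f x| ≤ M) →
      Integrable (fun x => max (f x) 0) P := fun f hf hfM =>
    integrable_of_continuous_of_bounded (by fun_prop) (C := M) fun x => by
      rw [abs_of_nonneg (le_max_right _ _)]; exact max_le ((le_abs_self _).trans (hfM x)) hM0
  have hNi : Integrable (fun x => √(∑ i, D i x ^ 2)) P :=
    integrable_of_continuous_of_bounded (by fun_prop) (C := √(∑ _i : Fin n, C ^ 2)) fun x => by
      rw [abs_of_nonneg (Real.sqrt_nonneg _)]
      exact Real.sqrt_le_sqrt (Finset.sum_le_sum fun i _ =>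
        sq_le_sq' (abs_le.1 (hC i x)).1 (abs_le.1 (hC i x)).2)
  have hs1 : MeasurableSet {x | 0 < g x} := measurableSet_lt measurable_const hg.measurable
  have hs2 : MeasurableSet {x | g x < 0} := measurableSet_lt hg.measurable measurable_const
  have habs : ∀ x, |g x| = max (g x) 0 + max (-g x) 0 := fun x => by
    rcases le_total 0 (g x) with h | h
    · rw [abs_of_nonneg h, max_eq_left h, max_eq_right (by linarith), add_zero]
    · rw [abs_of_nonpos h, max_eq_right h, max_eq_left (by linarith), zero_add]
  have hN : (∫ x, {x | 0 < g x}.indicator (fun x => √(∑ i, D i x ^ 2)) x ∂P) +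
      (∫ x, {x | g x < 0}.indicator (fun x => √(∑ i, D i x ^ 2)) x ∂P) ≤
      ∫ x, √(∑ i, D i x ^ 2) ∂P := by
    rw [← integral_add (hNi.indicator hs1) (hNi.indicator hs2)]
    refine integral_mono ((hNi.indicator hs1).add (hNi.indicator hs2)) hNi fun x => ?_
    have := Real.sqrt_nonneg (∑ i, D i x ^ 2)
    rcases lt_trichotomy (g x) 0 with h | h | h
    · simp [Set.indicator, h, h.le.not_gt]
    · simp [Set.indicator, h, this]
    · simp [Set.indicator, h, h.le.not_gt]
  simp_rw [habs]
  rw [integral_add (hgi g hg hM) (hgi (fun x => -g x) hg.neg fun x => by rw [abs_neg]; exact hM x)]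
  have h0 : 0 ≤ 2 * √6 * c := by positivity
  have := mul_le_mul_of_nonneg_left hN h0
  linarith

/-! ### Symmetric distributions with convex log-tail -/

theorem cdf_neg_of_symmetric {μ : Measure ℝ} [IsProbabilityMeasure μ]
    (hsymm : μ.map (fun x => -x) = μ) (hac : μ ≪ volume) (x : ℝ) :
    cdf μ (-x) = 1 - cdf μ x := by
  have hx : μ {x} = 0 := hac Real.volume_singleton
  have h1 : μ.real (Set.Iic (-x)) = μ.real (Set.Ici x) := by
    conv_lhs => rw [← hsymm]
    rw [measureReal_def, Measure.map_apply measurable_neg measurableSet_Iic, measureReal_def]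
    congr 2
    ext y
    simp
  have h2 : μ.real (Set.Ici x) = μ.real (Set.Ioi x) := by
    rw [measureReal_def, measureReal_def, measure_congr (Ioi_ae_eq_Ici' hx)]
  rw [cdf_eq_real, cdf_eq_real, h1, h2, ← Set.compl_Iic, probReal_compl_eq_one_sub measurableSet_Iic]

theorem cdf_zero_of_symmetric {μ : Measure ℝ} [IsProbabilityMeasure μ]
    (hsymm : μ.map (fun x => -x) = μ) (hac : μ ≪ volume) : cdf μ 0 = 1 / 2 := by
  have := cdf_neg_of_symmetric hsymm hac 0
  rw [neg_zero] at this
  linarith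

theorem convexOn_log_cdf {μ : Measure ℝ} [IsProbabilityMeasure μ] (hsymm : μ.map (fun x => -x) = μ) (hac : μ ≪ volume)
    (hconv : ConvexOn ℝ (Set.Ici 0) (fun x => Real.log (tailFunction μ x))) :
    ConvexOn ℝ (Set.Iic 0) (fun x => Real.log (cdf μ x)) := by
  have h := hconv.comp_linearMap (-LinearMap.id : ℝ →ₗ[ℝ] ℝ)
  have hs : (-LinearMap.id : ℝ →ₗ[ℝ] ℝ) ⁻¹' Set.Ici 0 = Set.Iic 0 := by ext; simp
  rw [hs] at h
  refine h.congr fun x _ => ?_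
  simp [tailFunction, cdf_neg_of_symmetric hsymm hac]

/-- The convention `log 0 = 0` must be ruled out. If `F` vanished at `x`, the function `log F` would
be `0` at `x - 1` and `x` but `log (1 / 2) < 0` at the origin, contradicting convexity. -/
theorem cdf_pos_of_convexOn_log {μ : Measure ℝ} [IsProbabilityMeasure μ] (hsymm : μ.map (fun x => -x) = μ) (hac : μ ≪ volume)
    (hconv : ConvexOn ℝ (Set.Iic 0) (fun x => Real.log (cdf μ x))) (x : ℝ) : 0 < cdf μ x := by
  by_contra! hx
  have h0 := cdf_zero_of_symmetric hsymm hac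
  have hx0 : cdf μ x = 0 := le_antisymm hx (cdf_nonneg _ _)
  have hy0 : cdf μ (x - 1) = 0 :=
    le_antisymm ((monotone_cdf μ (by linarith)).trans hx) (cdf_nonneg _ _)
  have hneg : x < 0 := by
    by_contra! h
    have := monotone_cdf μ h
    linarith
  have hlog : Real.log (cdf μ 0) < 0 := by
    rw [h0]; exact Real.log_neg (by norm_num) (by norm_num)
  have := hconv.secant_mono_aux1 (x := x - 1) (y := x) (z := 0) (by simp; linarith) (by simp)
    (by linarith) hneg
  simp only [hx0, hy0, Real.log_zero] at this
  nlinarith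

theorem convexOn_cdf {μ : Measure ℝ} (hpos : ∀ x, 0 < cdf μ x)
    (hconv : ConvexOn ℝ (Set.Iic 0) (fun x => Real.log (cdf μ x))) :
    ConvexOn ℝ (Set.Iic 0) (cdf μ) := by
  have h : ConvexOn ℝ (Set.Iic 0) (fun x => Real.exp (Real.log (cdf μ x))) :=
    ⟨hconv.1, fun x hx y hy a b ha hb hab =>
      (Real.exp_monotone (hconv.2 hx hy ha hb hab)).trans
        (convexOn_exp.2 (Set.mem_univ _) (Set.mem_univ _) ha hb hab)⟩
  refine h.congr fun x _ => Real.exp_log (hpos x)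

/-- Absolute continuity excludes atoms, so `F` takes the value `s` exactly at its generalized
inverse. -/
theorem cdf_cdfInverse {μ : Measure ℝ} [IsProbabilityMeasure μ] (hsymm : μ.map (fun x => -x) = μ) (hac : μ ≪ volume) {s : ℝ}
    (hs : s ∈ Set.Ioo (0 : ℝ) (1 / 2)) :
    cdf μ (cdfInverse μ s) = s ∧ cdfInverse μ s < 0 ∧ ∀ x < cdfInverse μ s, cdf μ x < s := by
  set b := cdfInverse μ s with hb
  have h0 := cdf_zero_of_symmetric hsymm hac
  have hbdd : BddBelow {x : ℝ | s ≤ cdf μ x} := by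
    obtain ⟨y, hy⟩ := ((tendsto_cdf_atBot μ).eventually (eventually_lt_nhds hs.1)).exists
    refine ⟨y, fun x hx => ?_⟩
    by_contra! h
    exact absurd (hx.trans (monotone_cdf μ h.le)) (not_le.2 hy)
  have hmem0 : (0 : ℝ) ∈ {x : ℝ | s ≤ cdf μ x} := by
    simp only [Set.mem_ofPred_eq, h0]; exact hs.2.le
  have hlt : ∀ x < b, cdf μ x < s := fun x hx => by
    by_contra! h
    exact absurd (csInf_le hbdd h) (not_le.2 hx)
  have hgt : ∀ x, b < x → s ≤ cdf μ x := fun x hx => by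
    obtain ⟨y, hy, hyx⟩ := exists_lt_of_csInf_lt ⟨0, hmem0⟩ hx
    exact le_trans hy (monotone_cdf μ hyx.le)
  have hge : s ≤ cdf μ b := by
    have : Filter.Tendsto (cdf μ) (nhdsWithin b (Set.Ioi b)) (nhds (cdf μ b)) :=
      ((cdf μ).right_continuous b).mono_left (nhdsWithin_mono _ Set.Ioi_subset_Ici_self)
    exact ge_of_tendsto this (eventually_nhdsWithin_of_forall fun x hx => hgt x hx)
  have hle : cdf μ b ≤ s := by
    have h1 : (cdf μ).measure {b} = 0 := by
      rw [measure_cdf]; exact hac Real.volume_singleton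
    rw [StieltjesFunction.measure_singleton, ENNReal.ofReal_eq_zero, sub_nonpos] at h1
    refine h1.trans ?_
    have : Filter.Tendsto (cdf μ) (nhdsWithin b (Set.Iio b)) (nhds (Function.leftLim (cdf μ) b)) :=
      (monotone_cdf μ).tendsto_leftLim b
    exact le_of_tendsto this (eventually_nhdsWithin_of_forall fun x hx => (hlt x hx).le)
  have heq := le_antisymm hle hge
  refine ⟨heq, lt_of_le_of_ne (csInf_le hbdd hmem0) fun h => ?_, hlt⟩
  rw [h, h0] at heq
  linarith [hs.2]

theorem ae_hasDerivAt_cdf (μ : Measure ℝ) [IsProbabilityMeasure μ] :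
    ∀ᵐ x, HasDerivAt (cdf μ) (μ.rnDeriv volume x).toReal x := by
  have := (cdf μ).ae_hasDerivAt
  rwa [measure_cdf] at this

theorem hasDerivWithinAt_cdf {μ : Measure ℝ} {s : ℝ} (hcF : ConvexOn ℝ (Set.Iic 0) (cdf μ))
    (hb : cdfInverse μ s < 0) :
    HasDerivWithinAt (cdf μ) (isoperimetricFunction μ s) (Set.Ioi (cdfInverse μ s))
      (cdfInverse μ s) :=
  hcF.hasDerivWithinAt_rightDeriv_of_mem_interior (by rwa [interior_Iic])

/-- By convexity the right derivative at `b` dominates the slope of `F` over `[b - 1, b]`, which is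
positive. -/
theorem isoperimetricFunction_pos {μ : Measure ℝ} {s : ℝ} (hcF : ConvexOn ℝ (Set.Iic 0) (cdf μ))
    (hb : cdfInverse μ s < 0) (hF : cdf μ (cdfInverse μ s) = s)
    (hlt : ∀ x < cdfInverse μ s, cdf μ x < s) : 0 < isoperimetricFunction μ s := by
  set b := cdfInverse μ s
  have h1 : cdf μ (b - 1) < s := hlt _ (by linarith)
  have h2 : cdf μ b - cdf μ (b - 1) ≤ isoperimetricFunction μ s := by
    have hd := hasDerivWithinAt_cdf hcF hb
    rw [hasDerivWithinAt_iff_tendsto_slope' (by simp)] at hd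
    refine ge_of_tendsto hd ?_
    filter_upwards [Ioo_mem_nhdsGT hb] with y hy
    have := hcF.slope_mono_adjacent (x := b - 1) (y := b) (z := y) (by simp; linarith)
      (by simpa using hy.2.le) (by linarith) hy.1
    rw [slope_def_field]
    simpa using this
  linarith

/-- The slope of the convex function `log F` between `b` and `x` is at least its right derivative `J
/ s` at `b` and at most its derivative `F' x / F x` at `x`. -/
theorem ae_cdf_le_mul_rnDeriv {μ : Measure ℝ} [IsProbabilityMeasure μ] {s : ℝ}
    (hpos : ∀ x, 0 < cdf μ x)
    (hconv : ConvexOn ℝ (Set.Iic 0) (fun x => Real.log (cdf μ x)))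
    (hb : cdfInverse μ s < 0) (hF : cdf μ (cdfInverse μ s) = s)
    (hJ : 0 < isoperimetricFunction μ s) :
    ∀ᵐ x, x ∈ Set.Ioo (cdfInverse μ s) 0 → ENNReal.ofReal (cdf μ x) ≤
      ENNReal.ofReal (s / isoperimetricFunction μ s) * μ.rnDeriv volume x := by
  have hs : 0 < s := hF ▸ hpos _
  have hd := hasDerivWithinAt_cdf (convexOn_cdf hpos hconv) hb
  set b := cdfInverse μ s
  set J := isoperimetricFunction μ s
  filter_upwards [ae_hasDerivAt_cdf μ, μ.rnDeriv_lt_top volume] with x hx hfin hxb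
  rw [← ENNReal.ofReal_toReal hfin.ne, ← ENNReal.ofReal_mul (by positivity)]
  refine ENNReal.ofReal_le_ofReal ?_
  have hb' : b ∈ Set.Iic (0 : ℝ) := hb.le
  have hx' : x ∈ Set.Iic (0 : ℝ) := hxb.2.le
  have h1 := hconv.le_slope_of_hasDerivWithinAt_Ioi hb' hx' hxb.1 (hd.log (hpos b).ne')
  have h2 := hconv.slope_le_of_hasDerivAt hb' hx' hxb.1 (hx.log (hpos x).ne')
  have h3 := h1.trans h2
  rw [hF, div_le_div_iff₀ hs (hpos x)] at h3
  rw [div_mul_eq_mul_div, le_div_iff₀ hJ]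
  linarith

/-- Controls the density where the cutoff varies. It may exceed `J` just to the right of `b`, so a
slope taken further right serves as the bound. -/
theorem ae_rnDeriv_le_slope {μ : Measure ℝ} [IsProbabilityMeasure μ]
    (hcF : ConvexOn ℝ (Set.Iic 0) (cdf μ)) {y z : ℝ} (hyz : y < z)
    (hz : z ≤ 0) :
    ∀ᵐ x, x < y → μ.rnDeriv volume x ≤ ENNReal.ofReal (slope (cdf μ) y z) := by
  filter_upwards [ae_hasDerivAt_cdf μ, μ.rnDeriv_lt_top volume] with x hx hfin hxy
  rw [← ENNReal.ofReal_toReal hfin.ne]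
  refine ENNReal.ofReal_le_ofReal ?_
  have hy' : y ∈ Set.Iic (0 : ℝ) := by simp; linarith
  have hx' : x ∈ Set.Iic (0 : ℝ) := by simp; linarith
  refine (hcF.le_slope_of_hasDerivAt hx' hy' hxy hx).trans ?_
  have := hcF.slope_mono_adjacent hx' hz hxy hyz
  rw [slope_def_field, slope_def_field]
  exact this

/-- This slope equals twice the slope over `[b, b + 2δ]` minus the slope over `[b, b + δ]`, so the
right derivative at `b` suffices and the limit is `2J - J`. -/
theorem tendsto_slope_cdf {μ : Measure ℝ} {s : ℝ}
    (hcF : ConvexOn ℝ (Set.Iic 0) (cdf μ)) (hb : cdfInverse μ s < 0) :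
    Filter.Tendsto (fun δ => slope (cdf μ) (cdfInverse μ s + δ) (cdfInverse μ s + 2 * δ))
      (nhdsWithin 0 (Set.Ioi 0)) (nhds (isoperimetricFunction μ s)) := by
  have hd := hasDerivWithinAt_cdf hcF hb
  rw [hasDerivWithinAt_iff_tendsto_slope' (by simp)] at hd
  set b := cdfInverse μ s
  have ht : ∀ k : ℝ, 0 < k → Filter.Tendsto (fun δ => b + k * δ) (nhdsWithin 0 (Set.Ioi 0))
      (nhdsWithin b (Set.Ioi b)) := fun k hk => by
    refine tendsto_nhdsWithin_iff.2 ⟨?_, eventually_nhdsWithin_of_forall fun δ hδ => ?_⟩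
    · have : Filter.Tendsto (fun δ => b + k * δ) (nhds 0) (nhds (b + k * 0)) :=
        Continuous.tendsto (by fun_prop) _
      rw [mul_zero, add_zero] at this
      exact this.mono_left nhdsWithin_le_nhds
    · have : 0 < k * δ := mul_pos hk hδ
      simpa using this
  have h1 := hd.comp (ht 1 one_pos)
  have h2 := hd.comp (ht 2 two_pos)
  have h := (h2.const_mul 2).sub h1
  rw [show 2 * isoperimetricFunction μ s - isoperimetricFunction μ s =
    isoperimetricFunction μ s by ring] at h
  refine h.congr' (eventually_nhdsWithin_of_forall fun δ hδ => ?_)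
  have : δ ≠ 0 := ne_of_gt hδ
  have h1 : b + 2 * δ - b = 2 * δ := by ring
  have h2 : b + δ - b = δ := by ring
  have h3 : b + 2 * δ - (b + δ) = δ := by ring
  simp only [Function.comp, slope_def_field, one_mul, h1, h2, h3]
  field_simp
  ring

/-! ### The Cheeger inequality for the truncated measure -/

theorem setLIntegral_eq_of_symmetric {μ : Measure ℝ} (hsymm : μ.map (fun x => -x) = μ)
    {k : ℝ → ℝ≥0∞} (hk : Measurable k) (s : Set ℝ) (hs : MeasurableSet s) :
    ∫⁻ x in s, k x ∂μ = ∫⁻ x in -s, k (-x) ∂μ := by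
  conv_lhs => rw [← hsymm]
  rw [setLIntegral_map hs hk measurable_neg]
  rfl

theorem ofReal_abs_comp_max_le {h h' : ℝ → ℝ} (hd : ∀ x, HasDerivAt h (h' x) x)
    (hc : Continuous h') (h0 : h 0 = 0) {b x : ℝ} (hb : b < 0) (hx : x ≤ 0) :
    ENNReal.ofReal |h (max b x)| ≤
      ∫⁻ t in Set.Ioo b 0, (Set.Ioi x).indicator (fun t => ENNReal.ofReal |h' t|) t := by
  set y := max b x
  have hy0 : y ≤ 0 := max_le hb.le hx
  have h1 : h y = - ∫ t in y..0, h' t := by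
    rw [intervalIntegral.integral_eq_sub_of_hasDerivAt (fun t _ => hd t)
      (hc.intervalIntegrable _ _), h0]
    ring
  have h2 : |h y| ≤ ∫ t in y..0, |h' t| := by
    rw [h1, abs_neg]
    exact intervalIntegral.abs_integral_le_integral_abs hy0
  calc ENNReal.ofReal |h y| ≤ ENNReal.ofReal (∫ t in y..0, |h' t|) := ENNReal.ofReal_le_ofReal h2
    _ = ∫⁻ t in Set.Ioo y 0, ENNReal.ofReal |h' t| := by
      rw [intervalIntegral.integral_of_le hy0, ← Measure.restrict_congr_set Ioo_ae_eq_Ioc,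
        ofReal_integral_eq_lintegral_ofReal _ (Filter.Eventually.of_forall fun t => abs_nonneg _)]
      exact ((hc.abs.integrableOn_Icc (a := y) (b := 0)).mono_set Set.Ioo_subset_Icc_self)
    _ ≤ _ := by
      rw [lintegral_indicator measurableSet_Ioi, Measure.restrict_restrict measurableSet_Ioi]
      refine lintegral_mono_set fun t ht => ⟨?_, ?_, ht.2⟩
      · exact (le_max_right _ _).trans_lt ht.1
      · exact (le_max_left _ _).trans_lt ht.1

/-- Writing `h` as an integral of `h'` up to `0` and exchanging the integrals weights `|h' t|` by `μ
(-∞, t)`, which is at most `F t` and hence at most `c` times the density. -/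
theorem lintegral_Iic_abs_comp_max_le {μ : Measure ℝ} [IsProbabilityMeasure μ]
    (hac : μ ≪ volume) {b c : ℝ} (hb : b < 0)
    (hF : ∀ᵐ x, x ∈ Set.Ioo b 0 → ENNReal.ofReal (cdf μ x) ≤
      ENNReal.ofReal c * μ.rnDeriv volume x)
    {h h' : ℝ → ℝ} (hd : ∀ x, HasDerivAt h (h' x) x) (hc : Continuous h') (h0 : h 0 = 0) :
    ∫⁻ x in Set.Iic 0, ENNReal.ofReal |h (max b x)| ∂μ ≤
      ENNReal.ofReal c * ∫⁻ x in Set.Ioo b 0, ENNReal.ofReal |h' x| ∂μ := by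
  have hm : Measurable fun t => ENNReal.ofReal |h' t| := by fun_prop
  calc ∫⁻ x in Set.Iic 0, ENNReal.ofReal |h (max b x)| ∂μ
      ≤ ∫⁻ x in Set.Iic 0, (∫⁻ t in Set.Ioo b 0,
          (Set.Ioi x).indicator (fun t => ENNReal.ofReal |h' t|) t) ∂μ :=
        setLIntegral_mono' measurableSet_Iic fun x hx => ofReal_abs_comp_max_le hd hc h0 hb hx
    _ ≤ ∫⁻ x, (∫⁻ t in Set.Ioo b 0,
          (Set.Ioi x).indicator (fun t => ENNReal.ofReal |h' t|) t) ∂μ :=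
        setLIntegral_le_lintegral _ _
    _ = ∫⁻ t in Set.Ioo b 0, (∫⁻ x, (Set.Ioi x).indicator (fun t => ENNReal.ofReal |h' t|) t ∂μ) := by
        refine lintegral_lintegral_swap ?_
        have : (Function.uncurry fun x t => (Set.Ioi x).indicator
            (fun t => ENNReal.ofReal |h' t|) t) =
            {p : ℝ × ℝ | p.1 < p.2}.indicator fun p => ENNReal.ofReal |h' p.2| := by
          ext ⟨x, t⟩
          simp [Set.indicator]
        rw [this]
        exact ((hm.comp measurable_snd).indicator
          (measurableSet_lt measurable_fst measurable_snd)).aemeasurable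
    _ ≤ ∫⁻ t in Set.Ioo b 0, ENNReal.ofReal c * (μ.rnDeriv volume t * ENNReal.ofReal |h' t|) := by
        refine lintegral_mono_ae ?_
        rw [ae_restrict_iff' measurableSet_Ioo]
        filter_upwards [hF] with t ht htb
        have : ∀ x, (Set.Ioi x).indicator (fun t => ENNReal.ofReal |h' t|) t =
            (Set.Iio t).indicator (fun _ => ENNReal.ofReal |h' t|) x := fun x => by
          simp [Set.indicator]
        simp_rw [this]
        rw [lintegral_indicator_const measurableSet_Iio, ← mul_assoc, mul_comm]
        refine mul_le_mul_left ?_ _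
        refine le_trans ?_ (ht htb)
        rw [ofReal_cdf]
        exact measure_mono Set.Iio_subset_Iic_self
    _ = _ := by
        rw [lintegral_const_mul _ (by fun_prop),
          setLIntegral_rnDeriv_mul hac hm.aemeasurable measurableSet_Ioo]

/-- The truncation of the line to the interval `[b, -b]`. -/
def clampSymm (b x : ℝ) : ℝ := max b (min x (-b))

theorem continuous_clampSymm (b : ℝ) : Continuous (clampSymm b) := by
  unfold clampSymm; fun_prop

theorem clampSymm_of_mem {b x : ℝ} (hx : x ∈ Set.Icc b (-b)) : clampSymm b x = x := by
  rw [clampSymm, min_eq_left hx.2, max_eq_right hx.1]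

theorem clampSymm_of_nonpos {b x : ℝ} (hb : b < 0) (hx : x ≤ 0) : clampSymm b x = max b x := by
  rw [clampSymm, min_eq_left (by linarith)]

theorem clampSymm_neg {b : ℝ} (hb : b < 0) (x : ℝ) : clampSymm b (-x) = - clampSymm b x := by
  simp only [clampSymm]
  rcases le_total x (-b) with h1 | h1 <;> rcases le_total b x with h2 | h2 <;>
    simp [max_def, min_def] <;> split_ifs <;> linarith

theorem cheegerAtZero_map_clampSymm {μ : Measure ℝ} [IsProbabilityMeasure μ]
    (hsymm : μ.map (fun x => -x) = μ) (hac : μ ≪ volume) {b c : ℝ} (hb : b < 0)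
    (hF : ∀ᵐ x, x ∈ Set.Ioo b 0 → ENNReal.ofReal (cdf μ x) ≤
      ENNReal.ofReal c * μ.rnDeriv volume x) :
    CheegerAtZero (μ.map (clampSymm b)) c := by
  intro h h' hd hc h0
  have hch : Continuous h := continuous_iff_continuousAt.2 fun x => (hd x).continuousAt
  have hT := (continuous_clampSymm b).measurable
  have hm : Measurable fun x => ENNReal.ofReal |h x| := by fun_prop
  have hm' : Measurable fun x => ENNReal.ofReal |h' x| := by fun_prop
  rw [lintegral_map hm hT, lintegral_map hm' hT]
  have left : ∫⁻ x in Set.Iic 0, ENNReal.ofReal |h (clampSymm b x)| ∂μ ≤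
      ENNReal.ofReal c * ∫⁻ x in Set.Ioo b 0, ENNReal.ofReal |h' x| ∂μ := by
    rw [setLIntegral_congr_fun measurableSet_Iic
      (fun x hx => by rw [clampSymm_of_nonpos hb hx])]
    exact lintegral_Iic_abs_comp_max_le hac hb hF hd hc h0
  have right : ∫⁻ x in Set.Ioi 0, ENNReal.ofReal |h (clampSymm b x)| ∂μ ≤
      ENNReal.ofReal c * ∫⁻ x in Set.Ioo 0 (-b), ENNReal.ofReal |h' x| ∂μ := by
    rw [setLIntegral_eq_of_symmetric hsymm (k := fun x => ENNReal.ofReal |h (clampSymm b x)|)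
        (hm.comp hT) _ measurableSet_Ioi,
      setLIntegral_eq_of_symmetric hsymm hm' _ measurableSet_Ioo]
    simp only [Set.neg_Ioi, Set.neg_Ioo, neg_zero, neg_neg]
    refine (lintegral_mono_set Set.Iio_subset_Iic_self).trans ?_
    have key := lintegral_Iic_abs_comp_max_le hac hb hF (h := fun x => h (-x))
      (h' := fun x => - h' (-x)) (fun x => ((hd (-x)).comp x (hasDerivAt_neg x)).congr_deriv (by simp))
      (by fun_prop) (by simpa using h0)
    simp only [abs_neg] at key
    refine le_trans (le_of_eq ?_) key
    refine setLIntegral_congr_fun measurableSet_Iic fun x hx => ?_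
    simp only [clampSymm_neg hb, clampSymm_of_nonpos hb hx]
  have hdisj : Disjoint (Set.Ioo b 0) (Set.Ioo 0 (-b)) :=
    Set.disjoint_left.2 fun x hx hx' => absurd hx.2 (not_lt.2 hx'.1.le)
  calc ∫⁻ x, ENNReal.ofReal |h (clampSymm b x)| ∂μ
      = (∫⁻ x in Set.Iic 0, ENNReal.ofReal |h (clampSymm b x)| ∂μ) +
        ∫⁻ x in Set.Ioi 0, ENNReal.ofReal |h (clampSymm b x)| ∂μ := by
        rw [← Set.compl_Iic, lintegral_add_compl _ measurableSet_Iic]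
    _ ≤ ENNReal.ofReal c * ((∫⁻ x in Set.Ioo b 0, ENNReal.ofReal |h' x| ∂μ) +
        ∫⁻ x in Set.Ioo 0 (-b), ENNReal.ofReal |h' x| ∂μ) := by
        rw [mul_add]; exact add_le_add left right
    -- The origin and the mass clamped to `±b` are not needed on the right; including them only
    -- enlarges it.
    _ ≤ ENNReal.ofReal c * ∫⁻ x, ENNReal.ofReal |h' (clampSymm b x)| ∂μ := by
        refine mul_le_mul_right ?_ _
        rw [← lintegral_union measurableSet_Ioo hdisj]
        refine le_trans (le_of_eq ?_) (setLIntegral_le_lintegral (Set.Ioo b 0 ∪ Set.Ioo 0 (-b)) _)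
        refine setLIntegral_congr_fun (measurableSet_Ioo.union measurableSet_Ioo) fun x hx => ?_
        have : x ∈ Set.Icc b (-b) := by
          rcases hx with hx | hx
          · exact ⟨hx.1.le, by linarith [hx.2]⟩
          · exact ⟨by linarith [hx.1], hx.2.le⟩
        rw [clampSymm_of_mem this]

/-! ### Cutoff functions -/

/-- `ψ` is a `C¹` function with derivative `ψ'` and values in `[0, 1]` that is supported in
`(b, -b)` and equal to `1` at distance at least `δ` from the endpoints. -/
structure IsCutoff (b δ : ℝ) (ψ ψ' : ℝ → ℝ) : Prop where
  hasDerivAt : ∀ x, HasDerivAt ψ (ψ' x) x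
  continuous_deriv : Continuous ψ'
  nonneg : ∀ x, 0 ≤ ψ x
  le_one : ∀ x, ψ x ≤ 1
  eq_one : ∀ x ∈ Set.Icc (b + δ) (-(b + δ)), ψ x = 1
  eq_zero : ∀ x ∉ Set.Ioo b (-b), ψ x = 0
  deriv_eq_zero : ∀ x ∉ Set.Ioo b (-b), ψ' x = 0

theorem IsCutoff.continuous {b δ : ℝ} {ψ ψ' : ℝ → ℝ} (h : IsCutoff b δ ψ ψ') : Continuous ψ :=
  continuous_iff_continuousAt.2 fun x => (h.hasDerivAt x).continuousAt

/-- A ramp over `[b, b + δ]` has derivative of Lebesgue mass one whatever `δ` is, so its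
`μ`-integral is at most the density bound `A`; the mirror ramp gives the factor `2`. -/
theorem exists_isCutoff {μ : Measure ℝ} [IsProbabilityMeasure μ]
    (hsymm : μ.map (fun x => -x) = μ) (hac : μ ≪ volume) {b δ A : ℝ} (hδ : 0 < δ)
    (hA : ∀ᵐ x, x < b + δ → μ.rnDeriv volume x ≤ ENNReal.ofReal A) :
    ∃ ψ ψ' : ℝ → ℝ, IsCutoff b δ ψ ψ' ∧
      ∫⁻ x, ENNReal.ofReal |ψ' x| ∂μ ≤ 2 * ENNReal.ofReal A := by
  obtain ⟨θ, θ', hθ, hθc', hθ'0, -, hθl, hθr, hθ0, hθ1, hθ'l, hθ'r⟩ := exists_step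
  have hθc : Continuous θ := continuous_iff_continuousAt.2 fun x => (hθ x).continuousAt
  set k : ℝ → ℝ := fun x => θ' ((x - b) / δ) / δ with hk
  have hkc : Continuous k := by simp only [hk]; fun_prop
  have hk0 : ∀ x, 0 ≤ k x := fun x => div_nonneg (hθ'0 _) hδ.le
  have hdk : ∀ x, HasDerivAt (fun x => θ ((x - b) / δ)) (k x) x := fun x => by
    have h1 := ((hasDerivAt_id x).sub_const b).div_const δ
    refine ((hθ ((x - b) / δ)).comp x h1).congr_deriv ?_
    simp only [hk]; ring
  have hkl : ∀ x ≤ b, k x = 0 := fun x hx => by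
    simp only [hk]
    rw [hθ'l _ (div_nonpos_of_nonpos_of_nonneg (by linarith) hδ.le), zero_div]
  have hkr : ∀ x, b + δ ≤ x → k x = 0 := fun x hx => by
    simp only [hk]
    rw [hθ'r _ ((one_le_div hδ).2 (by linarith)), zero_div]
  have hlz : ∀ x ≤ b, θ ((x - b) / δ) = 0 := fun x hx =>
    hθl _ (div_nonpos_of_nonpos_of_nonneg (by linarith) hδ.le)
  have hro : ∀ x, b + δ ≤ x → θ ((x - b) / δ) = 1 := fun x hx =>
    hθr _ ((one_le_div hδ).2 (by linarith))
  have hkm : Measurable fun x => ENNReal.ofReal (k x) := by fun_prop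
  have hki : ∫⁻ x, ENNReal.ofReal (k x) ≤ 1 := by
    have h1 : ∫⁻ x, ENNReal.ofReal (k x) = ∫⁻ x in Set.Ioc b (b + δ), ENNReal.ofReal (k x) := by
      refine (setLIntegral_eq_of_support_subset fun x hx => ?_).symm
      by_contra hx'
      refine hx ?_
      rcases le_or_gt x b with h | h
      · simp [hkl x h]
      · have : b + δ ≤ x := by
          by_contra! h'
          exact hx' ⟨h, h'.le⟩
        simp [hkr x this]
    rw [h1, ← ofReal_integral_eq_lintegral_ofReal
      ((hkc.integrableOn_Icc).mono_set Set.Ioc_subset_Icc_self)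
      (Filter.Eventually.of_forall hk0), ← intervalIntegral.integral_of_le (by linarith),
      intervalIntegral.integral_eq_sub_of_hasDerivAt (fun x _ => hdk x)
        (hkc.intervalIntegrable _ _), hlz b le_rfl, hro _ le_rfl]
    simp
  have hkμ : ∫⁻ x, ENNReal.ofReal (k x) ∂μ ≤ ENNReal.ofReal A := by
    rw [← lintegral_rnDeriv_mul hac hkm.aemeasurable]
    calc ∫⁻ x, μ.rnDeriv volume x * ENNReal.ofReal (k x)
        ≤ ∫⁻ x, ENNReal.ofReal A * ENNReal.ofReal (k x) := by
          refine lintegral_mono_ae ?_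
          filter_upwards [hA] with x hx
          rcases lt_or_ge x (b + δ) with h | h
          · exact mul_le_mul_left (hx h) _
          · simp [hkr x h]
      _ ≤ ENNReal.ofReal A := by
          rw [lintegral_const_mul _ hkm]
          exact (mul_le_mul_right hki _).trans_eq (mul_one _)
  have hkμ' : ∫⁻ x, ENNReal.ofReal (k (-x)) ∂μ ≤ ENNReal.ofReal A := by
    refine le_trans (le_of_eq ?_) hkμ
    conv_rhs => rw [← hsymm]
    rw [lintegral_map hkm measurable_neg]
  refine ⟨fun x => θ ((x - b) / δ) * θ ((-x - b) / δ),
    fun x => k x * θ ((-x - b) / δ) + θ ((x - b) / δ) * (- k (-x)), ⟨fun x => ?_, ?_, fun x => ?_,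
    fun x => ?_, fun x hx => ?_, fun x hx => ?_, fun x hx => ?_⟩, ?_⟩
  · refine (hdk x).mul ?_
    exact ((hdk (-x)).comp x (hasDerivAt_neg x)).congr_deriv (by simp)
  · fun_prop
  · exact mul_nonneg (hθ0 _) (hθ0 _)
  · exact mul_le_one₀ (hθ1 _) (hθ0 _) (hθ1 _)
  · rw [hro x hx.1, hro (-x) (by linarith [hx.2]), one_mul]
  · rcases le_or_gt x b with h | h
    · rw [hlz x h, zero_mul]
    · have : -x ≤ b := by
        by_contra! h'
        exact hx ⟨h, by linarith⟩
      rw [hlz _ this, mul_zero]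
  · rcases le_or_gt x b with h | h
    · rw [hlz x h, hkl x h]; simp
    · have : -x ≤ b := by
        by_contra! h'
        exact hx ⟨h, by linarith⟩
      rw [hlz _ this, hkl _ this]; simp
  · have hle : ∀ x, ENNReal.ofReal |k x * θ ((-x - b) / δ) + θ ((x - b) / δ) * (- k (-x))| ≤
        ENNReal.ofReal (k x) + ENNReal.ofReal (k (-x)) := fun x => by
      rw [← ENNReal.ofReal_add (hk0 _) (hk0 _)]
      refine ENNReal.ofReal_le_ofReal ?_
      have h1 := mul_le_of_le_one_right (hk0 x) (hθ1 ((-x - b) / δ))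
      have h2 := mul_le_of_le_one_left (hk0 (-x)) (hθ1 ((x - b) / δ))
      have h3 := mul_nonneg (hk0 x) (hθ0 ((-x - b) / δ))
      have h4 := mul_nonneg (hθ0 ((x - b) / δ)) (hk0 (-x))
      rw [abs_le]
      constructor <;> linarith [hk0 x, hk0 (-x)]
    refine (lintegral_mono hle).trans ?_
    rw [lintegral_add_left hkm, two_mul]
    exact add_le_add hkμ hkμ'

/-- The second vector will carry the cutoff derivatives. Its `ℓ¹` norm integrates coordinate by
coordinate, which produces the factor `n`. -/
theorem sqrt_sum_sq_add_le {ι : Type*} [Fintype ι] (u v : ι → ℝ) :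
    √(∑ i, (u i + v i) ^ 2) ≤ √(∑ i, u i ^ 2) + ∑ i, |v i| := by
  have h := norm_add_le (WithLp.toLp 2 u) (WithLp.toLp 2 v)
  simp only [EuclideanSpace.norm_eq, PiLp.add_apply, Real.norm_eq_abs, sq_abs] at h
  refine h.trans (add_le_add_right ?_ _)
  refine Real.sqrt_le_iff.2 ⟨Finset.sum_nonneg fun i _ => abs_nonneg _, ?_⟩
  have := Finset.sum_sq_le_sq_sum_of_nonneg (s := Finset.univ) (f := fun i => |v i|)
    fun i _ => abs_nonneg _
  simpa using this

/-! ### The truncated inequality on the product space -/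

theorem HasPartialDerivs.mul_prod {n : ℕ} {g : (Fin n → ℝ) → ℝ} {E : Fin n → (Fin n → ℝ) → ℝ}
    (hg : HasPartialDerivs g E) {ψ ψ' : ℝ → ℝ} (hψ : ∀ x, HasDerivAt ψ (ψ' x) x) :
    HasPartialDerivs (fun x => g x * ∏ j, ψ (x j)) (fun i x =>
      E i x * (∏ j, ψ (x j)) + g x * (ψ' (x i) * ∏ j ∈ Finset.univ \ {i}, ψ (x j))) := by
  intro i x
  have hprod : ∀ t, ∏ j, ψ (Function.update x i t j) =
      ψ t * ∏ j ∈ Finset.univ \ {i}, ψ (x j) := fun t => by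
    rw [← Finset.prod_update_of_mem (Finset.mem_univ i) (fun j => ψ (x j)) (ψ t)]
    refine Finset.prod_congr rfl fun j _ => ?_
    by_cases h : j = i
    · subst h; simp
    · simp [h]
  have h1 := (hg i x).mul ((hψ (x i)).mul_const (∏ j ∈ Finset.univ \ {i}, ψ (x j)))
  have h2 := hprod (x i)
  simp only [Function.update_eq_self] at h1 h2
  show HasDerivAt (fun t => g (Function.update x i t) * ∏ j, ψ (Function.update x i t j))
    (E i x * (∏ j, ψ (x j)) + g x * (ψ' (x i) * ∏ j ∈ Finset.univ \ {i}, ψ (x j))) (x i)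
  rw [h2]
  refine h1.congr_of_eventuallyEq (Filter.Eventually.of_forall fun t => ?_)
  simp only [hprod, Pi.mul_apply]

/-- The gradient of `f` may be unbounded, whereas the inequality for `ν` needs bounded derivatives;
cutting off supplies them by compactness. -/
theorem exists_bound_of_eq_zero_off_box {n : ℕ} {F : Type*} [NormedAddCommGroup F]
    {g : (Fin n → ℝ) → F} (hg : Continuous g) {b : ℝ}
    (h0 : ∀ x, (∃ j, x j ∉ Set.Ioo b (-b)) → g x = 0) : ∃ M, ∀ x, ‖g x‖ ≤ M := by
  have hK : IsCompact (Set.univ.pi fun _ : Fin n => Set.Icc b (-b)) :=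
    isCompact_univ_pi fun _ => isCompact_Icc
  obtain ⟨M, hM⟩ := hK.exists_bound_of_continuousOn hg.continuousOn
  refine ⟨max M 0, fun x => ?_⟩
  by_cases hx : ∃ j, x j ∉ Set.Ioo b (-b)
  · rw [h0 x hx, norm_zero]; exact le_max_right _ _
  · push Not at hx
    exact (hM x fun j _ => Set.Ioo_subset_Icc_self (hx j)).trans (le_max_left _ _)

theorem lintegral_pi_sum_eval {μ : Measure ℝ} [IsProbabilityMeasure μ] {n : ℕ} {k : ℝ → ℝ≥0∞}
    (hk : Measurable k) :
    ∫⁻ x, ∑ i, k (x i) ∂(Measure.pi fun _ : Fin n => μ) = n * ∫⁻ x, k x ∂μ := by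
  have hki : ∀ i, Measurable fun x : Fin n → ℝ => k (x i) :=
    fun i => hk.comp (measurable_pi_apply i)
  rw [lintegral_finsetSum _ fun i _ => hki i]
  simp_rw [(measurePreserving_eval (fun _ : Fin n => μ) _).lintegral_comp hk]
  simp

theorem lintegral_abs_sub_le_of_cutoff {μ : Measure ℝ} [IsProbabilityMeasure μ] {b δ c : ℝ}
    (hc : 0 ≤ c) (hμ : CheegerAtZero (μ.map (clampSymm b)) c) {ψ ψ' : ℝ → ℝ}
    (hψ : IsCutoff b δ ψ ψ') {n : ℕ} {f : (Fin n → ℝ) → ℝ} {E : Fin n → (Fin n → ℝ) → ℝ}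
    (hf : Continuous f) (hE : ∀ i, Continuous (E i)) (hfE : HasPartialDerivs f E) {m O : ℝ}
    (hO0 : 0 ≤ O) (hO : ∀ᵐ x ∂(Measure.pi fun _ : Fin n => μ), |f x - m| ≤ O)
    (hpos : (Measure.pi fun _ => μ).real {x | m < f x} ≤ 1 / 2)
    (hneg : (Measure.pi fun _ => μ).real {x | f x < m} ≤ 1 / 2) :
    ∫⁻ x, ENNReal.ofReal |f x - m| ∂(Measure.pi fun _ => μ) ≤
      ENNReal.ofReal (2 * √6 * c) *
        ((∫⁻ x, ENNReal.ofReal √(∑ i, E i x ^ 2) ∂(Measure.pi fun _ => μ)) +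
          ENNReal.ofReal O * (n * ∫⁻ x, ENNReal.ofReal |ψ' x| ∂μ)) +
      ENNReal.ofReal O * (n * μ (Set.Icc (b + δ) (-(b + δ)))ᶜ) := by
  set P : Measure (Fin n → ℝ) := Measure.pi fun _ => μ
  have hT := (continuous_clampSymm b).measurable
  have : IsProbabilityMeasure (μ.map (clampSymm b)) := Measure.isProbabilityMeasure_map hT.aemeasurable
  have hψc := hψ.continuous
  have hψc' := hψ.continuous_deriv
  set T : (Fin n → ℝ) → (Fin n → ℝ) := fun x i => clampSymm b (x i)
  have hTm : Measurable T := by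
    refine measurable_pi_lambda _ fun i => hT.comp (measurable_pi_apply i)
  have hmap : (Measure.pi fun _ : Fin n => μ.map (clampSymm b)) = P.map T :=
    (Measure.pi_map_pi fun _ => hT.aemeasurable).symm
  set χ : (Fin n → ℝ) → ℝ := fun x => ∏ j, ψ (x j) with hχ
  set g : (Fin n → ℝ) → ℝ := fun x => (f x - m) * χ x with hg
  set D : Fin n → (Fin n → ℝ) → ℝ := fun i x =>
    E i x * χ x + (f x - m) * (ψ' (x i) * ∏ j ∈ Finset.univ \ {i}, ψ (x j)) with hD
  have hχc : Continuous χ := by simp only [hχ]; fun_prop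
  have hgc : Continuous g := by simp only [hg]; fun_prop
  have hDc : ∀ i, Continuous (D i) := fun i => by simp only [hD]; fun_prop
  have hgD : HasPartialDerivs g D :=
    HasPartialDerivs.mul_prod (fun i x => (hfE i x).sub_const m) hψ.hasDerivAt
  have hχz : ∀ x, (∃ j, x j ∉ Set.Ioo b (-b)) → χ x = 0 := fun x ⟨j, hj⟩ =>
    Finset.prod_eq_zero (Finset.mem_univ j) (hψ.eq_zero _ hj)
  have hgz : ∀ x, (∃ j, x j ∉ Set.Ioo b (-b)) → g x = 0 := fun x hx => by
    simp only [hg, hχz x hx, mul_zero]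
  have hDz : ∀ i x, (∃ j, x j ∉ Set.Ioo b (-b)) → D i x = 0 := fun i x hx => by
    obtain ⟨j, hj⟩ := id hx
    simp only [hD, hχz x hx, mul_zero, zero_add]
    by_cases hij : j = i
    · rw [← hij, hψ.deriv_eq_zero _ hj]; simp
    · rw [Finset.prod_eq_zero (i := j) (by simp [hij]) (hψ.eq_zero _ hj)]; simp
  obtain ⟨M, hM⟩ := exists_bound_of_eq_zero_off_box hgc hgz
  obtain ⟨C, hC⟩ := exists_bound_of_eq_zero_off_box (g := fun x i => D i x)
    (continuous_pi fun i => hDc i) (fun x hx => funext fun i => hDz i x hx)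
  have hCi : ∀ i x, |D i x| ≤ C := fun i x => (norm_le_pi_norm (fun i => D i x) i).trans (hC x)
  -- `g` and its derivatives do not see the truncation
  have hTinv : ∀ (q : (Fin n → ℝ) → ℝ), (∀ x, (∃ j, x j ∉ Set.Ioo b (-b)) → q x = 0) →
      ∀ x, q (T x) = q x := fun q hq x => by
    by_cases hx : ∃ j, x j ∉ Set.Ioo b (-b)
    · rw [hq x hx, hq]
      obtain ⟨j, hj⟩ := hx
      refine ⟨j, fun hj' => hj ?_⟩
      simp only [T, clampSymm, Set.mem_Ioo, lt_max_iff, max_lt_iff, lt_min_iff, min_lt_iff,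
        lt_self_iff_false, false_or, or_false] at hj'
      exact ⟨hj'.1.1, hj'.2.2⟩
    · push Not at hx
      congr 1
      funext j
      exact clampSymm_of_mem (Set.Ioo_subset_Icc_self (hx j))
  have hχ0 : ∀ x, 0 ≤ χ x := fun x => Finset.prod_nonneg fun j _ => hψ.nonneg _
  have hχ1 : ∀ x, χ x ≤ 1 := fun x =>
    Finset.prod_le_one (fun j _ => hψ.nonneg _) fun j _ => hψ.le_one _
  have hgT := hTinv g hgz
  have hDT := fun i => hTinv (D i) (hDz i)
  -- Because `χ ≥ 0`, positivity of `g` forces `f > m` and negativity forces `f < m`, so `0`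
  -- inherits the median property.
  have hL1 := hμ.integral_abs_le hc hgc hDc hgD hM hCi
    (by
      rw [hmap, measureReal_def, Measure.map_apply hTm (measurableSet_lt measurable_const
        hgc.measurable)]
      refine le_trans (ENNReal.toReal_mono (measure_ne_top _ _) (measure_mono fun x hx => ?_)) hpos
      simp only [Set.mem_preimage, Set.mem_ofPred_eq, hgT] at hx ⊢
      have := pos_of_mul_pos_left hx (hχ0 x)
      linarith)
    (by
      rw [hmap, measureReal_def, Measure.map_apply hTm (measurableSet_lt hgc.measurable
        measurable_const)]
      refine le_trans (ENNReal.toReal_mono (measure_ne_top _ _) (measure_mono fun x hx => ?_)) hneg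
      simp only [Set.mem_preimage, Set.mem_ofPred_eq, hgT] at hx ⊢
      by_contra! h
      exact absurd hx (not_lt.2 (mul_nonneg (sub_nonneg.2 h) (hχ0 x))))
  rw [hmap, integral_map hTm.aemeasurable (by fun_prop), integral_map hTm.aemeasurable
    (Continuous.aestronglyMeasurable (by fun_prop))] at hL1
  simp only [hgT, hDT] at hL1
  have hgi : Integrable (fun x => |g x|) P :=
    integrable_of_continuous_of_bounded hgc.abs (C := M) fun x => by rw [abs_abs]; exact hM x
  have hDi : Integrable (fun x => √(∑ i, D i x ^ 2)) P :=
    integrable_of_continuous_of_bounded (by fun_prop) (C := √(∑ _i : Fin n, C ^ 2)) fun x => by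
      rw [abs_of_nonneg (Real.sqrt_nonneg _)]
      exact Real.sqrt_le_sqrt (Finset.sum_le_sum fun i _ =>
        sq_le_sq' (abs_le.1 (hCi i x)).1 (abs_le.1 (hCi i x)).2)
  have hL : ∫⁻ x, ENNReal.ofReal |g x| ∂P ≤
      ENNReal.ofReal (2 * √6 * c) * ∫⁻ x, ENNReal.ofReal √(∑ i, D i x ^ 2) ∂P := by
    rw [← ofReal_integral_eq_lintegral_ofReal hgi (Filter.Eventually.of_forall fun x =>
      abs_nonneg _), ← ofReal_integral_eq_lintegral_ofReal hDi (Filter.Eventually.of_forall fun x =>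
      Real.sqrt_nonneg _), ← ENNReal.ofReal_mul (by positivity)]
    exact ENNReal.ofReal_le_ofReal hL1
  have hκ : Measurable fun x => ENNReal.ofReal |ψ' x| := by fun_prop
  have hEm : Measurable fun x => ENNReal.ofReal √(∑ i, E i x ^ 2) :=
    ENNReal.measurable_ofReal.comp (Continuous.measurable (by fun_prop))
  have hgrad : ∫⁻ x, ENNReal.ofReal √(∑ i, D i x ^ 2) ∂P ≤
      (∫⁻ x, ENNReal.ofReal √(∑ i, E i x ^ 2) ∂P) +
        ENNReal.ofReal O * (n * ∫⁻ x, ENNReal.ofReal |ψ' x| ∂μ) := by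
    rw [← lintegral_pi_sum_eval hκ, ← lintegral_const_mul _ (by fun_prop),
      ← lintegral_add_left hEm]
    refine lintegral_mono_ae ?_
    filter_upwards [hO] with x hx
    rw [← ENNReal.ofReal_sum_of_nonneg fun i _ => abs_nonneg _, ← ENNReal.ofReal_mul hO0,
      ← ENNReal.ofReal_add (Real.sqrt_nonneg _)
        (mul_nonneg hO0 (Finset.sum_nonneg fun i _ => abs_nonneg _))]
    refine ENNReal.ofReal_le_ofReal ((sqrt_sum_sq_add_le _ _).trans (add_le_add ?_ ?_))
    · refine Real.sqrt_le_sqrt (Finset.sum_le_sum fun i _ => ?_)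
      rw [mul_pow]
      refine mul_le_of_le_one_right (sq_nonneg _) ?_
      exact pow_le_one₀ (hχ0 x) (hχ1 x)
    · rw [Finset.mul_sum]
      refine Finset.sum_le_sum fun i _ => ?_
      rw [abs_mul, abs_mul]
      refine mul_le_mul hx ?_ (by positivity) hO0
      refine mul_le_of_le_one_right (abs_nonneg _) ?_
      rw [abs_of_nonneg (Finset.prod_nonneg fun j _ => hψ.nonneg _)]
      exact Finset.prod_le_one (fun j _ => hψ.nonneg _) fun j _ => hψ.le_one _
  set S : Set ℝ := (Set.Icc (b + δ) (-(b + δ)))ᶜ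
  have hS : MeasurableSet S := measurableSet_Icc.compl
  have hSm : Measurable (S.indicator (1 : ℝ → ℝ≥0∞)) := measurable_one.indicator hS
  have hSi : ∀ i, Measurable fun x : Fin n → ℝ => S.indicator (1 : ℝ → ℝ≥0∞) (x i) :=
    fun i => hSm.comp (measurable_pi_apply i)
  -- Where all coordinates lie in the inner interval, `χ = 1` and `g = f - m`. Elsewhere `|f - m| ≤
  -- O`, and a union bound over coordinates applies.
  have hsplit : ∫⁻ x, ENNReal.ofReal |f x - m| ∂P ≤
      (∫⁻ x, ENNReal.ofReal |g x| ∂P) + ENNReal.ofReal O * (n * μ S) := by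
    rw [← lintegral_indicator_one hS, ← lintegral_pi_sum_eval hSm,
      ← lintegral_const_mul _ (Finset.measurable_fun_sum _ fun i _ => hSi i), ← lintegral_add_left (by fun_prop)]
    refine lintegral_mono_ae ?_
    filter_upwards [hO] with x hx
    by_cases hxS : ∃ i, x i ∈ S
    · obtain ⟨i, hi⟩ := hxS
      refine le_trans ?_ le_add_self
      refine (ENNReal.ofReal_le_ofReal hx).trans ?_
      refine le_mul_of_one_le_right (zero_le) ?_
      have h1 : S.indicator (1 : ℝ → ℝ≥0∞) (x i) = 1 := by simp [hi]
      rw [← h1]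
      exact Finset.single_le_sum (f := fun i => S.indicator (1 : ℝ → ℝ≥0∞) (x i))
        (fun _ _ => zero_le) (Finset.mem_univ i)
    · have hone : χ x = 1 := Finset.prod_eq_one fun j _ => hψ.eq_one _ (by
        by_contra h
        exact hxS ⟨j, h⟩)
      simp only [hg, hone, mul_one]
      exact le_self_add
  calc ∫⁻ x, ENNReal.ofReal |f x - m| ∂P ≤ _ := hsplit
    _ ≤ _ := add_le_add_left (hL.trans (mul_le_mul_right hgrad _)) _

/-! ### Euclidean space -/

theorem hasPartialDerivs_comp_toLp {n : ℕ} {f : EuclideanSpace ℝ (Fin n) → ℝ}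
    (hf : Differentiable ℝ f) :
    HasPartialDerivs (fun x => f (WithLp.toLp 2 x)) (fun i x => gradient f (WithLp.toLp 2 x) i) := by
  intro i x
  have h1 : HasDerivAt (fun t : ℝ => WithLp.toLp 2 x + (t - x i) • EuclideanSpace.single i (1 : ℝ))
      (EuclideanSpace.single i (1 : ℝ)) (x i) := by
    simpa using (((hasDerivAt_id (x i)).sub_const (x i)).smul_const
      (EuclideanSpace.single i (1 : ℝ))).const_add (WithLp.toLp 2 x)
  have h2 : ∀ t : ℝ, WithLp.toLp 2 (Function.update x i t) =
      WithLp.toLp 2 x + (t - x i) • EuclideanSpace.single i (1 : ℝ) := fun t => by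
    ext j
    by_cases h : j = i
    · subst h; simp
    · simp [h]
  simp only [h2]
  have h3 := (hf (WithLp.toLp 2 x)).hasGradientAt.hasFDerivAt
  have h4 : WithLp.toLp 2 x = WithLp.toLp 2 x + (x i - x i) • EuclideanSpace.single i (1 : ℝ) := by
    simp
  have h5 := HasFDerivAt.comp_hasDerivAt (x i) (h4 ▸ h3) h1
  refine h5.congr_deriv ?_
  rw [sub_self, zero_smul, add_zero, InnerProductSpace.toDual_apply_apply,
    EuclideanSpace.inner_single_right]
  simp

theorem continuous_gradient {E : Type*} [NormedAddCommGroup E] [InnerProductSpace ℝ E]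
    [CompleteSpace E] {f : E → ℝ} (hf : ContDiff ℝ 1 f) : Continuous (gradient f) :=
  (InnerProductSpace.toDual ℝ E).symm.continuous.comp (hf.continuous_fderiv one_ne_zero)

/-! ### Medians and oscillation -/

/-- A median lies between the essential infimum and supremum, since each of its half-spaces has
positive measure. -/
theorem ae_abs_sub_median_le_essOscillation {Ω : Type*} [MeasurableSpace Ω] {P : Measure Ω}
    {f : Ω → ℝ} {m C : ℝ} (hC : ∀ x, |f x| ≤ C) (hm : IsMedian P f m) :
    ∀ᵐ x ∂P, |f x - m| ≤ essOscillation P f := by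
  have hb1 : Filter.IsBoundedUnder (· ≤ ·) (ae P) f :=
    Filter.isBoundedUnder_of ⟨C, fun x => (abs_le.1 (hC x)).2⟩
  have hb2 : Filter.IsBoundedUnder (· ≥ ·) (ae P) f :=
    Filter.isBoundedUnder_of ⟨-C, fun x => (abs_le.1 (hC x)).1⟩
  have h1 := ae_le_essSup hb1
  have h2 := ae_essInf_le hb2
  have half : (0 : ℝ≥0∞) < 1 / 2 := by simp
  have h3 : essInf f P ≤ m := by
    by_contra! h
    refine absurd hm.1 (not_le.2 (lt_of_eq_of_lt ?_ half))
    refine measure_mono_null (fun x hx => ?_) (ae_iff.1 h2)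
    exact not_le.2 (lt_of_le_of_lt hx h)
  have h4 : m ≤ essSup f P := by
    by_contra! h
    refine absurd hm.2 (not_le.2 (lt_of_eq_of_lt ?_ half))
    refine measure_mono_null (fun x hx => ?_) (ae_iff.1 h1)
    exact not_le.2 (lt_of_lt_of_le h hx)
  filter_upwards [h1, h2] with x hx1 hx2
  rw [essOscillation, abs_le]
  constructor <;> linarith

theorem measureReal_compl_le_half {Ω : Type*} [MeasurableSpace Ω] {P : Measure Ω}
    [IsProbabilityMeasure P] {s : Set Ω} (hs : MeasurableSet s) (h : 1 / 2 ≤ P s) :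
    P.real sᶜ ≤ 1 / 2 := by
  rw [probReal_compl_eq_one_sub hs, measureReal_def]
  have := ENNReal.toReal_mono (measure_ne_top P s) h
  have h2 : (1 / 2 : ℝ≥0∞).toReal = 1 / 2 := by simp
  linarith

theorem measure_compl_Icc_symm_le {μ : Measure ℝ} [IsProbabilityMeasure μ]
    (hsymm : μ.map (fun x => -x) = μ) (y : ℝ) :
    μ (Set.Icc y (-y))ᶜ ≤ 2 * ENNReal.ofReal (cdf μ y) := by
  have h1 : (Set.Icc y (-y))ᶜ ⊆ Set.Iic y ∪ Set.Ici (-y) := fun x hx => by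
    by_contra! h
    simp only [Set.mem_union, Set.mem_Iic, Set.mem_Ici, not_or, not_le] at h
    exact hx ⟨h.1.le, h.2.le⟩
  have h2 : μ (Set.Ici (-y)) = μ (Set.Iic y) := by
    conv_lhs => rw [← hsymm]
    rw [Measure.map_apply measurable_neg measurableSet_Ici]
    congr 1
    ext x
    simp
  calc μ (Set.Icc y (-y))ᶜ ≤ μ (Set.Iic y) + μ (Set.Ici (-y)) :=
        (measure_mono h1).trans (measure_union_le _ _)
    _ = 2 * ENNReal.ofReal (cdf μ y) := by rw [h2, ofReal_cdf, two_mul]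

/-! ### The main theorem -/

theorem theorem3 (μ : Measure ℝ) [IsProbabilityMeasure μ]
    (hsymm : μ.map (fun x => -x) = μ)
    (hac : μ ≪ volume)
    (hconv : ConvexOn ℝ (Set.Ici 0) (fun x => Real.log (tailFunction μ x)))
    (n : ℕ) (f : EuclideanSpace ℝ (Fin n) → ℝ)
    (hf : ContDiff ℝ ∞ f) (hbdd : ∃ C : ℝ, ∀ x, |f x| ≤ C)
    (m : ℝ) (hm : IsMedian (productMeasure μ n) f m) :
    ∀ s ∈ Set.Ioo (0 : ℝ) (1 / 2),
      0 < isoperimetricFunction μ s ∧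
      ∫⁻ x, ENNReal.ofReal |f x - m| ∂(productMeasure μ n) ≤
        ENNReal.ofReal (2 * Real.sqrt 6 * (s / isoperimetricFunction μ s)) *
            ∫⁻ x, ENNReal.ofReal ‖gradient f x‖ ∂(productMeasure μ n) +
          ENNReal.ofReal
            (2 * (1 + 2 * Real.sqrt 6) * n * s * essOscillation (productMeasure μ n) f) := by
  intro s hs
  have hlogF := convexOn_log_cdf hsymm hac hconv
  have hFpos := cdf_pos_of_convexOn_log hsymm hac hlogF
  have hF := convexOn_cdf hFpos hlogF
  obtain ⟨hFb, hb, hlt⟩ := cdf_cdfInverse hsymm hac hs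
  have hJ := isoperimetricFunction_pos hF hb hFb hlt
  refine ⟨hJ, ?_⟩
  have hcheeger := cheegerAtZero_map_clampSymm hsymm hac hb
    (ae_cdf_le_mul_rnDeriv hFpos hlogF hb hFb hJ)
  have hslope := tendsto_slope_cdf hF hb
  have hcdf : Filter.Tendsto (fun δ => cdf μ (cdfInverse μ s + δ)) (nhdsWithin 0 (Set.Ioi 0))
      (nhds s) := by
    have h1 : Filter.Tendsto (fun δ => cdfInverse μ s + δ) (nhdsWithin (0 : ℝ) (Set.Ioi 0))
        (nhdsWithin (cdfInverse μ s) (Set.Ici (cdfInverse μ s))) := by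
      refine tendsto_nhdsWithin_iff.2 ⟨?_, eventually_nhdsWithin_of_forall fun δ hδ => ?_⟩
      · have : Filter.Tendsto (fun δ : ℝ => cdfInverse μ s + δ) (nhds 0)
            (nhds (cdfInverse μ s + 0)) := Continuous.tendsto (by fun_prop) _
        rw [add_zero] at this
        exact this.mono_left nhdsWithin_le_nhds
      · have : (0 : ℝ) < δ := hδ
        simpa using this.le
    have h2 := ((cdf μ).right_continuous (cdfInverse μ s)).tendsto.comp h1
    rwa [hFb] at h2
  set b := cdfInverse μ s
  set J := isoperimetricFunction μ s
  set O := essOscillation (productMeasure μ n) f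
  obtain ⟨C, hC⟩ := hbdd
  have hOae := ae_abs_sub_median_le_essOscillation hC hm
  set P : Measure (Fin n → ℝ) := Measure.pi fun _ => μ
  set e := MeasurableEquiv.toLp 2 (Fin n → ℝ)
  have hQ : productMeasure μ n = P.map e := rfl
  have : IsProbabilityMeasure (productMeasure μ n) := by
    rw [hQ]; exact Measure.isProbabilityMeasure_map e.measurable.aemeasurable
  have hO0 : 0 ≤ O := by
    obtain ⟨x, hx⟩ := hOae.exists
    exact (abs_nonneg _).trans hx
  have hfc := hf.continuous
  have htoLp : Continuous fun x : Fin n → ℝ => WithLp.toLp 2 x := PiLp.continuous_toLp 2 _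
  have hgrad := continuous_gradient (hf.of_le (by exact_mod_cast le_top))
  have hOae' : ∀ᵐ x ∂P, |f (WithLp.toLp 2 x) - m| ≤ O := by
    rw [hQ] at hOae
    exact ae_of_ae_map e.measurable.aemeasurable hOae
  have hpos : P.real {x | m < f (WithLp.toLp 2 x)} ≤ 1 / 2 := by
    have := measureReal_compl_le_half (P := P) (s := {x | f (WithLp.toLp 2 x) ≤ m})
      (measurableSet_le (hfc.comp htoLp).measurable measurable_const) (by
        have := hm.1
        rwa [hQ, e.map_apply] at this)
    refine le_trans (le_of_eq ?_) this
    congr 1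
    ext x
    simp
  have hneg : P.real {x | f (WithLp.toLp 2 x) < m} ≤ 1 / 2 := by
    have := measureReal_compl_le_half (P := P) (s := {x | m ≤ f (WithLp.toLp 2 x)})
      (measurableSet_le measurable_const (hfc.comp htoLp).measurable) (by
        have := hm.2
        rwa [hQ, e.map_apply] at this)
    refine le_trans (le_of_eq ?_) this
    congr 1
    ext x
    simp
  have hc : 0 ≤ s / J := div_nonneg hs.1.le hJ.le
  set L := ∫⁻ x, ENNReal.ofReal ‖gradient f x‖ ∂(productMeasure μ n) with hL
  have hLP : ∫⁻ x, ENNReal.ofReal √(∑ i, gradient f (WithLp.toLp 2 x) i ^ 2) ∂P = L := by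
    rw [hL, hQ, lintegral_map_equiv]
    refine lintegral_congr fun x => ?_
    rw [EuclideanSpace.norm_eq]
    simp only [Real.norm_eq_abs, sq_abs]
    rfl
  have hLHS : ∫⁻ x, ENNReal.ofReal |f x - m| ∂(productMeasure μ n) =
      ∫⁻ x, ENNReal.ofReal |f (WithLp.toLp 2 x) - m| ∂P := by
    rw [hQ, lintegral_map_equiv]
    rfl
  rw [hLHS]
  -- the inequality for a cutoff of width `δ`
  have hδ : ∀ δ ∈ Set.Ioo 0 (-b / 2), ∫⁻ x, ENNReal.ofReal |f (WithLp.toLp 2 x) - m| ∂P ≤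
      ENNReal.ofReal (2 * √6 * (s / J)) * L + ENNReal.ofReal (2 * √6 * (s / J) *
        (O * (n * (2 * slope (cdf μ) (b + δ) (b + 2 * δ)))) +
        O * (n * (2 * cdf μ (b + δ)))) := by
    intro δ hδ
    have hsl : 0 ≤ slope (cdf μ) (b + δ) (b + 2 * δ) := by
      rw [slope_def_field]
      exact div_nonneg (sub_nonneg.2 (monotone_cdf μ (by linarith [hδ.1]))) (by linarith [hδ.1])
    obtain ⟨ψ, ψ', hψ, hψi⟩ := exists_isCutoff hsymm hac (b := b) hδ.1
      (ae_rnDeriv_le_slope hF (y := b + δ) (z := b + 2 * δ) (by linarith [hδ.1])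
        (by linarith [hδ.2]))
    have key := lintegral_abs_sub_le_of_cutoff hc hcheeger hψ (hfc.comp htoLp)
      (E := fun i x => gradient f (WithLp.toLp 2 x) i) (fun i => by
        have := hgrad.comp htoLp
        exact (PiLp.continuous_apply 2 _ i).comp this)
      (hasPartialDerivs_comp_toLp (hf.differentiable (by simp))) hO0 hOae' hpos hneg
    refine key.trans ?_
    rw [hLP, mul_add, add_assoc]
    refine add_le_add_right ?_ _
    have hFb' := cdf_nonneg μ (b + δ)
    rw [ENNReal.ofReal_add (by positivity) (by positivity)]
    have hscale : ∀ r : ℝ, ENNReal.ofReal (O * (n * (2 * r))) =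
        ENNReal.ofReal O * (n * (2 * ENNReal.ofReal r)) := fun r => by
      rw [ENNReal.ofReal_mul hO0, ENNReal.ofReal_mul n.cast_nonneg,
        ENNReal.ofReal_mul zero_le_two, ENNReal.ofReal_natCast, ENNReal.ofReal_ofNat]
    refine add_le_add ?_ ?_
    · rw [ENNReal.ofReal_mul (p := 2 * √6 * (s / J)) (by positivity), hscale]
      gcongr
    · rw [hscale]
      gcongr
      exact measure_compl_Icc_symm_le hsymm _
  -- The slope tends to `J` and cancels the denominator of `s / J`; the cdf tends to `s`.
  have hlim : Filter.Tendsto (fun δ => 2 * √6 * (s / J) *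
        (O * (n * (2 * slope (cdf μ) (b + δ) (b + 2 * δ)))) +
        O * (n * (2 * cdf μ (b + δ)))) (nhdsWithin 0 (Set.Ioi 0))
      (nhds (2 * (1 + 2 * √6) * n * s * O)) := by
    have h := ((((hslope.const_mul 2).const_mul (n : ℝ)).const_mul O).const_mul
      (2 * √6 * (s / J))).add (((hcdf.const_mul 2).const_mul (n : ℝ)).const_mul O)
    convert h using 2
    field_simp
    ring
  -- The gradient term is independent of `δ`, so the limit is legitimate even when that term is
  -- infinite.
  refine ge_of_tendsto ((ENNReal.tendsto_ofReal hlim).const_add _) ?_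
  filter_upwards [Ioo_mem_nhdsGT (show (0 : ℝ) < -b / 2 by linarith)] with δ h using hδ δ h
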